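/- **Theorem 4.1 ($M_{4B}$).** *Setting.* Consider tuples $(R,M,A,\langle\,,\rangle)$ where $R$ is an integral domain containing $\mathbb R$; $M$ is a commutative, not necessarily associative, $R$-algebra generated by six distinct marked elements $A=\{a_1,a_{-1},a_2,a_{-2},a_3,a_{-3}\}$; $\langle\,,\rangle$ is an $R$-valued bilinear form on $M$ with $\langle u,v\cdot w\rangle=\langle u\cdot v,w\rangle$; and $R$ is generated as an $\mathbb R$-algebra by the values of the form on the (non-associative) products of the marked generators. Morphisms are pairs consisting of an $\mathbb R$-algebra homomorphism $\varphi$ of coefficient rings and a $\varphi$-semilinear multiplicative map $\psi$ with $\langle \psi u,\psi v\rangle=\varphi(\langle u,v\rangle)$ that sends each marked generator to the corresponding one. Let $\mathcal C_{4B}$ be the class of those tuples for which: 1. each $a\in A$ is a primitive axis of Monster type with $\langle a,a\rangle=1$. That is, with $M_\lambda=\{v\in M: a\cdot v=\lambda v\}$: $a\cdot a=a$; $M=M_1\oplus M_0\oplus M_{1/4}\oplus M_{1/32}$; $M_1=Ra$; and $M_\lambda\cdot M_\mu\subseteq\bigoplus_{\nu\in\lambda*\mu}M_\nu$, where $*$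 is the symmetric Monster fusion rule $1*1=\{1\}$, $1*0=\emptyset$, $0*0=\{0\}$, $1*\mu=0*\mu=\{\mu\}$ for $\mu\in\{\frac14,\frac1{32}\}$, $\frac14*\frac14=\{1,0\}$, $\frac14*\frac1{32}=\{\frac1{32}\}$, $\frac1{32}*\frac1{32}=\{1,0,\frac14\}$; 2. for $i\in\{1,2,3\}$ the Miyamoto involutions $\tau(a_i)$ and $\tau(a_{-i})$ (where $\tau(a)$ is the identity on $M_1\oplus M_0\oplus M_{1/4}$ and $-1$ on $M_{1/32}$) both fix $a_i$ and $a_{-i}$, and both interchange $a_j$ and $a_{-j}$ for each $j\in\{1,2,3\}\setminus\{i\}$; 3. (shape $4B$) the subalgebra generated by $a_1$ and $a_2$ is the dihedral algebra of type $4B$: it is free with basis $a_1,a_{-1},a_2,a_{-2},c$ for some $c$, these five elements are idempotents, and for $i,j\in\{\pm1,\pm2\}$ with $|i|\ne|j|$ $$a_i\cdot a_j=\tfrac1{64}(a_i+a_j-a_{-i}-a_{-j}+c),\quad a_i\cdot a_{-i}=\tfrac18(a_i+a_{-i}-c),\quad a_i\cdot c=\tfrac18(a_i+c-a_{-i}),$$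 $$\langle a_i,a_j\rangle=\tfrac1{64},\quad \langle a_i,a_{-i}\rangle=\langle a_i,c\rangle=\tfrac18,\quad \langle a_i,a_i\rangle=\langle c,c\rangle=1.$$ A universal algebra of shape $4B$ is a member of $\mathcal C_{4B}$ of which every member of $\mathcal C_{4B}$ is a quotient, by a unique morphism (surjective both on the algebra and on the coefficient ring). *Claim.* A universal algebra $M_{4B}$ of shape $4B$ exists. For every such algebra, its coefficient ring is $\mathbb R$ (the inclusion of $\mathbb R$ into it is bijective), and $M_{4B}$ is $7$-dimensional, with basis $$a_1,\ a_{-1},\ a_2,\ a_{-2},\ a_3,\ a_{-3},\ a_\rho,\qquad a_\rho:=a_1+a_{-1}-8\,a_1\cdot a_{-1}.$$ -/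

import Mathlib

universe u v

/-- Labels for the four elements `1, 0, 1/4, 1/32` of the Monster fusion rule. -/
inductive MonsterLabel : Type
  | one | zero | quarter | thirtySecond
  deriving DecidableEq

namespace MonsterLabel

/-- The number named by a label. -/
noncomputable def val : MonsterLabel → ℝ
  | one => 1
  | zero => 0
  | quarter => 1 / 4
  | thirtySecond => 1 / 32

/-- The Monster (Majorana) fusion rule. -/
def star : MonsterLabel → MonsterLabel → Set MonsterLabel
  | one, one => {one}
  | one, zero => ∅
  | one, quarter => {quarter}
  | one, thirtySecond => {thirtySecond}
  | zero, one => ∅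
  | zero, zero => {zero}
  | zero, quarter => {quarter}
  | zero, thirtySecond => {thirtySecond}
  | quarter, one => {quarter}
  | quarter, zero => {quarter}
  | quarter, quarter => {one, zero}
  | quarter, thirtySecond => {thirtySecond}
  | thirtySecond, one => {thirtySecond}
  | thirtySecond, zero => {thirtySecond}
  | thirtySecond, quarter => {thirtySecond}
  | thirtySecond, thirtySecond => {one, zero, quarter}

end MonsterLabel

section Axes

variable (R : Type*) {M : Type*} [CommRing R] [Algebra ℝ R] [NonUnitalNonAssocCommRing M]
  [Module R M] [SMulCommClass R M M] [IsScalarTower R M M]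

/-- The eigenspace of the adjoint map `v ↦ a * v` for the eigenvalue named by the label `l`. -/
noncomputable def adEigenspace (a : M) (l : MonsterLabel) : Submodule R M :=
  Module.End.eigenspace (LinearMap.mulLeft R a) (algebraMap ℝ R l.val)

/-- The sum of the eigenspaces of the adjoint map of `a` over a set of labels. -/
noncomputable def adEigenspaces (a : M) (s : Set MonsterLabel) : Submodule R M :=
  ⨆ l ∈ s, adEigenspace R a l

/-- `a` is an idempotent, `M` is the direct sum of the eigenspaces of its adjoint map for the
eigenvalues `1, 0, 1/4, 1/32`, and these eigenspaces obey the Monster fusion rule. -/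
structure IsMonsterAxis (a : M) : Prop where
  idem : a * a = a
  semisimple : DirectSum.IsInternal (adEigenspace R a)
  fusion : ∀ (l m : MonsterLabel), ∀ u ∈ adEigenspace R a l, ∀ v ∈ adEigenspace R a m,
    u * v ∈ adEigenspaces R a (MonsterLabel.star l m)

/-- The axis `a` is primitive: its `1`-eigenspace is spanned by `a`. -/
def IsPrimitiveAxis (a : M) : Prop :=
  adEigenspace R a .one = Submodule.span R {a}

/-- `τ` is the Miyamoto involution of the axis `a`. (As `M` is the direct sum of the eigenspaces
of an axis, there is exactly one such map for each axis.) -/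
structure IsMiyamotoInvolution (a : M) (τ : M ≃ₗ[R] M) : Prop where
  map_even : ∀ v ∈ adEigenspaces R a {.one, .zero, .quarter}, τ v = v
  map_odd : ∀ v ∈ adEigenspace R a .thirtySecond, τ v = -v

/-- The subalgebra generated by `a₀` and `a₁` is a dihedral algebra of type `4B`, where `am₁` is
the image of `a₁` under the Miyamoto involution of `a₀`, and `a₂` that of `a₀` under the one of
`a₁`: it has a basis `am₁, a₀, a₁, a₂, c` with the products and the values of the form of the
dihedral algebra of type `4B`. -/
def IsDihedral4B (form : LinearMap.BilinForm R M) (a₀ a₁ am₁ a₂ : M) : Prop :=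
  ∃ c : M,
    LinearIndependent R ![am₁, a₀, a₁, a₂, c] ∧
    Submodule.span R {am₁, a₀, a₁, a₂, c} =
      (NonUnitalAlgebra.adjoin R {a₀, a₁}).toSubmodule ∧
    -- the five basis vectors are idempotents
    (am₁ * am₁ = am₁ ∧ a₀ * a₀ = a₀ ∧ a₁ * a₁ = a₁ ∧ a₂ * a₂ = a₂ ∧ c * c = c) ∧
    -- products of neighbouring axes
    ((64 : R) • (a₀ * a₁) = a₀ + a₁ - am₁ - a₂ + c ∧
      (64 : R) • (a₀ * am₁) = a₀ + am₁ - a₁ - a₂ + c ∧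
      (64 : R) • (a₂ * a₁) = a₂ + a₁ - am₁ - a₀ + c ∧
      (64 : R) • (a₂ * am₁) = a₂ + am₁ - a₁ - a₀ + c) ∧
    -- the two subalgebras of type 2A, which share the vector `c`
    ((8 : R) • (a₀ * a₂) = a₀ + a₂ - c ∧ (8 : R) • (a₁ * am₁) = a₁ + am₁ - c ∧
      (8 : R) • (a₀ * c) = a₀ + c - a₂ ∧ (8 : R) • (a₂ * c) = a₂ + c - a₀ ∧
      (8 : R) • (a₁ * c) = a₁ + c - am₁ ∧ (8 : R) • (am₁ * c) = am₁ + c - a₁) ∧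
    -- the form
    (form am₁ am₁ = 1 ∧ form a₀ a₀ = 1 ∧ form a₁ a₁ = 1 ∧ form a₂ a₂ = 1 ∧ form c c = 1) ∧
    (form a₀ a₁ = algebraMap ℝ R (1 / 64) ∧ form a₀ am₁ = algebraMap ℝ R (1 / 64) ∧
      form a₂ a₁ = algebraMap ℝ R (1 / 64) ∧ form a₂ am₁ = algebraMap ℝ R (1 / 64)) ∧
    (form a₀ a₂ = algebraMap ℝ R (1 / 8) ∧ form a₁ am₁ = algebraMap ℝ R (1 / 8) ∧
      form a₀ c = algebraMap ℝ R (1 / 8) ∧ form a₂ c = algebraMap ℝ R (1 / 8) ∧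
      form a₁ c = algebraMap ℝ R (1 / 8) ∧ form am₁ c = algebraMap ℝ R (1 / 8))

end Axes

/-- A commutative, not necessarily associative, algebra `M` over a coefficient ring `R`, an
integral domain containing `ℝ`, with a bilinear form that associates with the product, and with
generators marked by `ι`. The coefficient ring is generated over `ℝ` by the values of the form on
the products of the marked generators. -/
structure MarkedFrobeniusAlgebra (ι : Type) : Type (u + 1) where
  R : Type u
  M : Type u
  [commRing : CommRing R]
  [isDomain : IsDomain R]
  [realAlgebra : Algebra ℝ R]
  [mulRing : NonUnitalNonAssocCommRing M]
  [module : Module R M]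
  [smulComm : SMulCommClass R M M]
  [scalarTower : IsScalarTower R M M]
  gen : ι → M
  form : LinearMap.BilinForm R M
  form_assoc : ∀ u v w : M, form u (v * w) = form (u * v) w
  adjoin_gen : NonUnitalAlgebra.adjoin R (Set.range gen) = ⊤
  adjoin_form : Algebra.adjoin ℝ {r : R | ∃ x ∈ Subsemigroup.closure (Set.range gen),
    ∃ y ∈ Subsemigroup.closure (Set.range gen), r = form x y} = ⊤

namespace MarkedFrobeniusAlgebra

attribute [instance] commRing isDomain realAlgebra mulRing module smulComm scalarTower

/-- A morphism: an `ℝ`-algebra map of coefficient rings and a compatible additive map of algebras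
that preserves the product, the form and the marked generators. -/
@[ext] structure Hom {ι : Type} (𝓐 : MarkedFrobeniusAlgebra.{u} ι)
    (𝓑 : MarkedFrobeniusAlgebra.{v} ι) : Type (max u v) where
  ringMap : 𝓐.R →ₐ[ℝ] 𝓑.R
  map : 𝓐.M →+ 𝓑.M
  map_smul : ∀ (r : 𝓐.R) (x : 𝓐.M), map (r • x) = ringMap r • map x
  map_mul : ∀ x y : 𝓐.M, map (x * y) = map x * map y
  map_form : ∀ x y : 𝓐.M, 𝓑.form (map x) (map y) = ringMap (𝓐.form x y)
  map_gen : ∀ i : ι, map (𝓐.gen i) = 𝓑.gen i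

end MarkedFrobeniusAlgebra

/-- Labels of the six axes: `(i, 1)` stands for `a_{i+1}` and `(i, -1)` for `a_{-(i+1)}`. -/
abbrev AxisIndex : Type := Fin 3 × ℤˣ

/-- The permutation of the labels induced by the Miyamoto involution of the axis labelled `i`:
it fixes `a_{±k}` for the `k` of that axis, and negates the index of the four other axes. -/
def axisPerm (i j : AxisIndex) : AxisIndex :=
  if j.1 = i.1 then j else (j.1, -j.2)

/-- Primitive Frobenius axial algebras of Monster type, generated by six marked axes
`a_{±1}, a_{±2}, a_{±3}` that are permuted by their Miyamoto involutions as prescribed,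
and of shape `4B`. -/
structure IsShape4B (𝓐 : MarkedFrobeniusAlgebra.{u} AxisIndex) : Prop where
  gen_injective : Function.Injective 𝓐.gen
  axis : ∀ i, IsMonsterAxis 𝓐.R (𝓐.gen i)
  primitive : ∀ i, IsPrimitiveAxis 𝓐.R (𝓐.gen i)
  form_axis : ∀ i, 𝓐.form (𝓐.gen i) (𝓐.gen i) = 1
  miyamoto : ∀ i, ∃ τ : 𝓐.M ≃ₗ[𝓐.R] 𝓐.M, IsMiyamotoInvolution 𝓐.R (𝓐.gen i) τ ∧
    ∀ j, τ (𝓐.gen j) = 𝓐.gen (axisPerm i j)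
  shape : IsDihedral4B 𝓐.R 𝓐.form
    (𝓐.gen (0, 1)) (𝓐.gen (1, 1)) (𝓐.gen (1, -1)) (𝓐.gen (0, -1))

/-- `𝓐` is a universal algebra of shape `4B`: it has shape `4B`, and every algebra of shape `4B`
is a quotient of it, by a unique morphism. -/
def IsUniversal4B (𝓐 : MarkedFrobeniusAlgebra.{u} AxisIndex) : Prop :=
  IsShape4B 𝓐 ∧ ∀ 𝓑 : MarkedFrobeniusAlgebra.{v} AxisIndex, IsShape4B 𝓑 →
    ∃ f : MarkedFrobeniusAlgebra.Hom 𝓐 𝓑, Function.Surjective f.ringMap ∧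
      Function.Surjective f.map ∧ ∀ g : MarkedFrobeniusAlgebra.Hom 𝓐 𝓑, g = f

/-- The vector `a_ρ = a_1 + a_{-1} - 8 a_1 a_{-1}`. -/
def aRho (𝓐 : MarkedFrobeniusAlgebra.{u} AxisIndex) : 𝓐.M :=
  𝓐.gen (0, 1) + 𝓐.gen (0, -1) - (8 : 𝓐.R) • (𝓐.gen (0, 1) * 𝓐.gen (0, -1))

/-!
Let the Miyamoto involutions of the axes `a` and `a'` interchange `b` and `b'`, and vice versa. Up
to a scalar and a multiple of `a + b`, the product `a * b` is a vector `σ` that depends only on the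
two pairs. Eigenvectors of `a` for the eigenvalues `0` and `1/4` are read off `b + b'` and `a * b`,
and the fusion rules `0 * 0` and `0 * 1/4` applied to them (the resurrection principle) determine
`a * (b * b')` and `σ * σ`. The formula for `σ * σ` is not symmetric in the four axes, and
comparing its versions expresses everything through `a`, `a'`, `b`, `b'` and `a * a'`. If `a`, `a'`
generate an algebra of type `2A` with third axis `c`, then so do `b`, `b'`, with the same `c`. Hence
in an algebra of shape `4B` the six axes and `a_ρ` multiply according to one table.

The table is realized over `ℝ` in dimension `7`, where `a_ρ` and the three vectors
`(4 (a_i + a_{-i}) - a_ρ) / 5` are orthogonal idempotents. This model maps onto every algebra of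
shape `4B`. Its form is positive definite, so that over the coefficient ring the image of its basis
is still a basis.
-/

section Eigenspaces

variable {R M : Type*} [CommRing R] [Algebra ℝ R] [NonUnitalNonAssocCommRing M] [Module R M]
  [SMulCommClass R M M]

theorem isUnit_ofNat_of_algebra_real (n : ℕ) [n.AtLeastTwo] : IsUnit (OfNat.ofNat n : R) := by
  rw [← map_ofNat (algebraMap ℝ R) n]
  exact (isUnit_iff_ne_zero.2 (OfNat.ofNat_ne_zero n)).map (algebraMap ℝ R)

theorem MonsterLabel.val_injective : Function.Injective MonsterLabel.val := by
  intro l m h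
  cases l <;> cases m <;> first | rfl | norm_num [MonsterLabel.val] at h

theorem mem_adEigenspace {a v : M} {l : MonsterLabel} :
    v ∈ adEigenspace R a l ↔ a * v = algebraMap ℝ R l.val • v := by
  simp [adEigenspace]

theorem mem_adEigenspace_one {a v : M} : v ∈ adEigenspace R a .one ↔ a * v = v := by
  simp [mem_adEigenspace, MonsterLabel.val]

theorem mem_adEigenspace_zero {a v : M} : v ∈ adEigenspace R a .zero ↔ a * v = 0 := by
  simp [mem_adEigenspace, MonsterLabel.val]

theorem mem_adEigenspace_of_val_eq_one_div {a v : M} {l : MonsterLabel} {n : ℕ} [n.AtLeastTwo]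
    (hl : l.val = 1 / OfNat.ofNat n) :
    v ∈ adEigenspace R a l ↔ (OfNat.ofNat n : R) • (a * v) = v := by
  have hn : (OfNat.ofNat n : R) * algebraMap ℝ R l.val = 1 := by
    rw [hl, ← map_ofNat (algebraMap ℝ R), ← map_mul, mul_one_div_cancel (OfNat.ofNat_ne_zero n),
      map_one]
  rw [mem_adEigenspace, ← (isUnit_ofNat_of_algebra_real (R := R) n).smul_left_cancel, smul_smul, hn,
    one_smul]

theorem mem_adEigenspace_quarter {a v : M} :
    v ∈ adEigenspace R a .quarter ↔ (4 : R) • (a * v) = v :=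
  mem_adEigenspace_of_val_eq_one_div rfl

theorem mem_adEigenspace_thirtySecond {a v : M} :
    v ∈ adEigenspace R a .thirtySecond ↔ (32 : R) • (a * v) = v :=
  mem_adEigenspace_of_val_eq_one_div rfl

theorem adEigenspaces_singleton (a : M) (l : MonsterLabel) :
    adEigenspaces R a {l} = adEigenspace R a l := by
  simp [adEigenspaces]

theorem adEigenspaces_insert (a : M) (l : MonsterLabel) (s : Set MonsterLabel) :
    adEigenspaces R a (insert l s) = adEigenspace R a l ⊔ adEigenspaces R a s := by
  simp only [adEigenspaces, iSup_insert]

theorem adEigenspaces_univ (a : M) : adEigenspaces R a Set.univ = ⨆ l, adEigenspace R a l := by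
  simp [adEigenspaces]

theorem adEigenspace_le_adEigenspaces (a : M) {l : MonsterLabel} {s : Set MonsterLabel}
    (hl : l ∈ s) : adEigenspace R a l ≤ adEigenspaces R a s :=
  le_iSup₂_of_le l hl le_rfl

theorem four_mul_form_mul_of_mem_quarter (form : LinearMap.BilinForm R M) {a q : M}
    (hq : q ∈ adEigenspace R a .quarter) (v : M) : 4 * form (a * q) v = form q v := by
  conv_rhs => rw [← mem_adEigenspace_quarter.1 hq]
  simp only [map_smul, LinearMap.smul_apply, smul_eq_mul]

theorem form_eq_zero_of_mem_adEigenspace {form : LinearMap.BilinForm R M}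
    (hform : ∀ u v w : M, form u (v * w) = form (u * v) w) {a u v : M} {l m : MonsterLabel}
    (hu : u ∈ adEigenspace R a l) (hv : v ∈ adEigenspace R a m) (hlm : l ≠ m) : form u v = 0 := by
  have hval : algebraMap ℝ R l.val * form u v = algebraMap ℝ R m.val * form u v := by
    have := hform u a v
    rw [mem_adEigenspace.1 hv, mul_comm u a, mem_adEigenspace.1 hu] at this
    simpa only [map_smul, LinearMap.smul_apply, smul_eq_mul] using this.symm
  have hunit : IsUnit (algebraMap ℝ R (l.val - m.val)) :=
    (isUnit_iff_ne_zero.2 (sub_ne_zero.2 (MonsterLabel.val_injective.ne hlm))).map _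
  apply hunit.mul_right_eq_zero.1
  rw [map_sub, sub_mul, hval, sub_self]

end Eigenspaces

section PrimitiveAxis

variable {R M : Type*} [CommRing R] [Algebra ℝ R] [NonUnitalNonAssocCommRing M] [Module R M]
  [SMulCommClass R M M]

/-- A primitive axis of Monster type and of length one. -/
structure IsPrimitiveMonsterAxis (form : LinearMap.BilinForm R M) (a : M) : Prop where
  isMonsterAxis : IsMonsterAxis R a
  isPrimitiveAxis : IsPrimitiveAxis R a
  form_self : form a a = 1

namespace IsPrimitiveMonsterAxis

variable {form : LinearMap.BilinForm R M} {a : M} (ha : IsPrimitiveMonsterAxis form a)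
include ha

theorem mul_self : a * a = a :=
  ha.isMonsterAxis.idem

theorem mem_one : a ∈ adEigenspace R a .one :=
  mem_adEigenspace_one.2 ha.mul_self

theorem exists_even_add_odd (v : M) : ∃ x ∈ adEigenspaces R a {.one, .zero, .quarter},
    ∃ y ∈ adEigenspace R a .thirtySecond, v = x + y := by
  have huniv : (Set.univ : Set MonsterLabel) = {.thirtySecond, .one, .zero, .quarter} := by
    ext l; cases l <;> simp
  have hv : v ∈ adEigenspaces R a Set.univ := by
    rw [adEigenspaces_univ, ha.isMonsterAxis.semisimple.submodule_iSup_eq_top]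
    trivial
  rw [huniv, adEigenspaces_insert] at hv
  obtain ⟨y, hy, x, hx, rfl⟩ := Submodule.mem_sup.1 hv
  exact ⟨x, hx, y, hy, add_comm y x⟩

variable (hform : ∀ u v w : M, form u (v * w) = form (u * v) w)
include hform

theorem exists_eq_smul_add_zero {v : M} (hv : v ∈ adEigenspaces R a {.one, .zero}) :
    ∃ v₀ ∈ adEigenspace R a .zero, v = form a v • a + v₀ := by
  rw [adEigenspaces_insert, adEigenspaces_singleton, ha.isPrimitiveAxis] at hv
  obtain ⟨_, ha', v₀, h₀, rfl⟩ := Submodule.mem_sup.1 hv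
  obtain ⟨r, rfl⟩ := Submodule.mem_span_singleton.1 ha'
  refine ⟨v₀, h₀, ?_⟩
  simp [ha.form_self, form_eq_zero_of_mem_adEigenspace hform ha.mem_one h₀]

theorem exists_eq_smul_add_zero_add_quarter {v : M}
    (hv : v ∈ adEigenspaces R a {.one, .zero, .quarter}) :
    ∃ v₀ ∈ adEigenspace R a .zero, ∃ v₄ ∈ adEigenspace R a .quarter,
      v = form a v • a + v₀ + v₄ := by
  rw [show ({.one, .zero, .quarter} : Set MonsterLabel) = {.quarter, .one, .zero} by aesop,
    adEigenspaces_insert] at hv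
  obtain ⟨v₄, h₄, w, hw, rfl⟩ := Submodule.mem_sup.1 hv
  obtain ⟨v₀, h₀, hw₀⟩ := ha.exists_eq_smul_add_zero hform hw
  refine ⟨v₀, h₀, v₄, h₄, ?_⟩
  rw [map_add, form_eq_zero_of_mem_adEigenspace hform ha.mem_one h₄ (by decide), zero_add, ← hw₀,
    add_comm]

theorem form_comm (v : M) : form a v = form v a := by
  obtain ⟨x, hx, y, hy, rfl⟩ := ha.exists_even_add_odd v
  obtain ⟨x₀, h₀, x₄, h₄, hx'⟩ := ha.exists_eq_smul_add_zero_add_quarter hform hx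
  have orth {l : MonsterLabel} {w : M} (hw : w ∈ adEigenspace R a l) (hl : l ≠ .one) :
      form w a = 0 :=
    form_eq_zero_of_mem_adEigenspace hform hw ha.mem_one hl
  rw [map_add, map_add, LinearMap.add_apply, orth hy (by decide),
    form_eq_zero_of_mem_adEigenspace hform ha.mem_one hy (by decide)]
  conv_rhs => rw [hx']
  simp [orth h₀, orth h₄, ha.form_self]

theorem four_smul_mul_mul_self_of_mem_quarter {q : M} (hq : q ∈ adEigenspace R a .quarter) :
    (4 : R) • (a * (q * q)) = form q q • a := by
  have hqq := ha.isMonsterAxis.fusion _ _ _ hq _ hq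
  simp only [MonsterLabel.star] at hqq
  obtain ⟨z, hz, hqqz⟩ := ha.exists_eq_smul_add_zero hform hqq
  have hmul : a * (q * q) = form a (q * q) • a := calc
    a * (q * q) = a * (form a (q * q) • a + z) := congrArg (a * ·) hqqz
    _ = form a (q * q) • a := by
      rw [mul_add, mul_smul_comm, ha.mul_self, mem_adEigenspace_zero.1 hz, add_zero]
  rw [hmul, smul_smul, hform, four_mul_form_mul_of_mem_quarter form hq]

end IsPrimitiveMonsterAxis

/-- The component in the `1 / 4`-eigenspace of an axis `a` of a vector `v` in the sum of the
eigenspaces for `1`, `0` and `1 / 4`. -/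
def quarterPart (form : LinearMap.BilinForm R M) (a v : M) : M :=
  (4 : R) • (a * v - form a v • a)

namespace IsPrimitiveMonsterAxis

variable {form : LinearMap.BilinForm R M} {a v : M} (ha : IsPrimitiveMonsterAxis form a)
  (hform : ∀ u v w : M, form u (v * w) = form (u * v) w)
  (hv : v ∈ adEigenspaces R a {.one, .zero, .quarter})
include ha hform hv

theorem quarterPart_mem_and_sub_mem : quarterPart form a v ∈ adEigenspace R a .quarter ∧
    v - form a v • a - quarterPart form a v ∈ adEigenspace R a .zero := by
  obtain ⟨v₀, h₀, v₄, h₄, hv'⟩ := ha.exists_eq_smul_add_zero_add_quarter hform hv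
  have hav : (4 : R) • (a * v) = (4 * form a v) • a + v₄ := by
    conv_lhs => rw [hv']
    simp only [mul_add, mul_smul_comm, ha.mul_self, mem_adEigenspace_zero.1 h₀]
    linear_combination (norm := module) mem_adEigenspace_quarter.1 h₄
  have hq : quarterPart form a v = v₄ := by
    rw [quarterPart]
    linear_combination (norm := module) hav
  have hz : v - form a v • a - v₄ = v₀ := by
    linear_combination (norm := module) hv'
  rw [hq, hz]
  exact ⟨h₄, h₀⟩

theorem form_quarterPart_self : form (quarterPart form a v) (quarterPart form a v) =
    4 * (form a (v * v) - form a v ^ 2) := by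
  have hq := (ha.quarterPart_mem_and_sub_mem hform hv).1
  have hqa : form (quarterPart form a v) a = 0 :=
    form_eq_zero_of_mem_adEigenspace hform hq ha.mem_one (by decide)
  calc form (quarterPart form a v) (quarterPart form a v)
      = 4 * form (quarterPart form a v) (a * v) := by
        have (u : M) :
            form u (quarterPart form a v) = 4 * (form u (a * v) - form a v * form u a) := by
          simp only [quarterPart, map_smul, map_sub, smul_eq_mul]
        rw [this, hqa, mul_zero, sub_zero]
    _ = form (quarterPart form a v) v := by
        rw [hform, mul_comm _ a, four_mul_form_mul_of_mem_quarter form hq]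
    _ = 4 * (form a (v * v) - form a v ^ 2) := by
        simp only [quarterPart, map_smul, map_sub, LinearMap.smul_apply, LinearMap.sub_apply,
          smul_eq_mul, hform]
        ring

/-- The resurrection principle: `p - q` and `q` are the `0`- and `1/4`-components of `v`, so that
the fusion rules `0 * 0` and `0 * 1/4` apply to them. -/
theorem resurrection {p q : M} (hp : p = v - form a v • a) (hq : q = quarterPart form a v) :
    a * (p * p) - (2 : R) • (a * (p * q)) + a * (q * q) = 0 ∧
    (4 : R) • (a * (p * q) - a * (q * q)) = p * q - q * q := by
  obtain ⟨hq', hz⟩ := ha.quarterPart_mem_and_sub_mem hform hv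
  rw [← hq] at hq' hz
  rw [← hp] at hz
  have hzz := ha.isMonsterAxis.fusion _ _ _ hz _ hz
  have hzq := ha.isMonsterAxis.fusion _ _ _ hz _ hq'
  simp only [MonsterLabel.star, adEigenspaces_singleton] at hzz hzq
  rw [mem_adEigenspace_zero] at hzz
  rw [mem_adEigenspace_quarter] at hzq
  simp only [sub_mul, mul_sub, mul_comm q p] at hzz hzq
  constructor
  · linear_combination (norm := module) hzz
  · linear_combination (norm := module) hzq

end IsPrimitiveMonsterAxis

end PrimitiveAxis

section MiyamotoQuad

theorem smul_add_smul_add_mul_self {R M : Type*} [CommRing R] [NonUnitalNonAssocCommRing M]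
    [Module R M] [SMulCommClass R M M] [IsScalarTower R M M] (r s : R) (x y z : M) :
    (r • x + s • y + z) * (r • x + s • y + z) =
      r ^ 2 • (x * x) + s ^ 2 • (y * y) + z * z +
        (2 : R) • ((r * s) • (y * x) + r • (x * z) + s • (y * z)) := by
  simp only [add_mul, mul_add, smul_mul_assoc, mul_smul_comm, mul_comm x y, mul_comm z x,
    mul_comm z y]
  module

variable {R M : Type*} [CommRing R] [Algebra ℝ R] [NonUnitalNonAssocCommRing M] [Module R M]
  [SMulCommClass R M M]

/-- The Miyamoto involution of the axis `a` interchanges `b` and `b'`, expressed through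
eigenspaces. -/
structure IsMiyamotoPair (R : Type*) {M : Type*} [CommRing R] [Algebra ℝ R]
    [NonUnitalNonAssocCommRing M] [Module R M] [SMulCommClass R M M] (a b b' : M) : Prop where
  sub_mem : b - b' ∈ adEigenspace R a .thirtySecond
  add_mem : b + b' ∈ adEigenspaces R a {.one, .zero, .quarter}

theorem IsPrimitiveMonsterAxis.isMiyamotoPair {form : LinearMap.BilinForm R M} {a : M}
    (ha : IsPrimitiveMonsterAxis form a) {τ : M ≃ₗ[R] M} (hτ : IsMiyamotoInvolution R a τ)
    (v : M) : IsMiyamotoPair R a v (τ v) := by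
  obtain ⟨x, hx, y, hy, rfl⟩ := ha.exists_even_add_odd v
  rw [map_add, hτ.map_even x hx, hτ.map_odd y hy]
  constructor
  · convert Submodule.smul_mem _ (2 : R) hy using 1
    module
  · convert Submodule.smul_mem _ (2 : R) hx using 1
    module

/-- The vector `32 σ(a, b)`, where `σ(a, b) = a * b - (a + b) / 32` is the vector that is invariant
under the Miyamoto involutions of both axes `a` and `b`. -/
def dihedralInvariant (R : Type*) {M : Type*} [CommRing R] [NonUnitalNonAssocCommRing M]
    [Module R M] (a b : M) : M :=
  (32 : R) • (a * b) - a - b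

theorem dihedralInvariant_comm (R : Type*) {M : Type*} [CommRing R]
    [NonUnitalNonAssocCommRing M] [Module R M] (a b : M) :
    dihedralInvariant R a b = dihedralInvariant R b a := by
  rw [dihedralInvariant, dihedralInvariant, mul_comm a b, sub_right_comm]

namespace IsMiyamotoPair

variable {form : LinearMap.BilinForm R M} {a b b' : M} (h : IsMiyamotoPair R a b b')
include h

theorem symm : IsMiyamotoPair R a b' b :=
  ⟨neg_sub b b' ▸ neg_mem h.sub_mem, add_comm b b' ▸ h.add_mem⟩

theorem dihedralInvariant_eq : dihedralInvariant R a b = dihedralInvariant R a b' := by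
  have hsub := mem_adEigenspace_thirtySecond.1 h.sub_mem
  rw [mul_sub] at hsub
  rw [dihedralInvariant, dihedralInvariant]
  linear_combination (norm := module) hsub

theorem mul_add_eq : (32 : R) • (a * (b + b')) =
    (2 : R) • dihedralInvariant R a b + (2 : R) • a + (b + b') := by
  have hS : (2 : R) • dihedralInvariant R a b =
      dihedralInvariant R a b + dihedralInvariant R a b' := by
    rw [← h.dihedralInvariant_eq]
    module
  rw [hS, dihedralInvariant, dihedralInvariant, mul_add]
  module

variable (ha : IsPrimitiveMonsterAxis form a)
  (hform : ∀ u v w : M, form u (v * w) = form (u * v) w)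
include ha hform

theorem form_eq : form a b = form a b' := by
  rw [← sub_eq_zero, ← map_sub]
  exact form_eq_zero_of_mem_adEigenspace hform ha.mem_one h.sub_mem (by decide)

theorem form_add_eq : form a (b + b') = 2 * form a b := by
  rw [map_add, ← h.form_eq ha hform, two_mul]

theorem eight_smul_quarterPart : (8 : R) • quarterPart form a (b + b') =
    (2 : R) • dihedralInvariant R a b + (2 - 64 * form a b) • a + (b + b') := by
  rw [quarterPart, h.form_add_eq ha hform]
  linear_combination (norm := module) h.mul_add_eq

theorem mul_dihedralInvariant : (64 : R) • (a * dihedralInvariant R a b) =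
    (14 : R) • dihedralInvariant R a b + (1536 * form a b - 50) • a + (7 : R) • (b + b') := by
  have hq := mem_adEigenspace_quarter.1 (ha.quarterPart_mem_and_sub_mem hform h.add_mem).1
  have haq := congrArg (a * ·) (h.eight_smul_quarterPart ha hform)
  simp only [mul_add a (_ + _), mul_add a (_ • _), mul_smul_comm, ha.mul_self] at haq
  linear_combination (norm := module)
    (64 : R) • hq + (8 : R) • h.eight_smul_quarterPart ha hform - (32 : R) • haq - h.mul_add_eq

end IsMiyamotoPair

/-- The products and the value of the form that two axes `a` and `a'` and the vector `c` satisfy in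
a dihedral algebra of type `2A`. -/
structure IsDihedral2A (form : LinearMap.BilinForm R M) (a a' c : M) : Prop where
  mul_eq : (8 : R) • (a * a') = a + a' - c
  mul_third : (8 : R) • (a * c) = a + c - a'
  mul_third' : (8 : R) • (a' * c) = a' + c - a
  form_eq : 8 * form a a' = 1

/-- Two pairs of primitive axes of Monster type such that the Miyamoto involution of each axis of
one pair interchanges the two axes of the other pair. -/
structure IsMiyamotoQuad (form : LinearMap.BilinForm R M) (a a' b b' : M) : Prop where
  axis_left : IsPrimitiveMonsterAxis form a
  axis_left' : IsPrimitiveMonsterAxis form a'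
  axis_right : IsPrimitiveMonsterAxis form b
  axis_right' : IsPrimitiveMonsterAxis form b'
  pair_left : IsMiyamotoPair R a b b'
  pair_left' : IsMiyamotoPair R a' b b'
  pair_right : IsMiyamotoPair R b a a'
  pair_right' : IsMiyamotoPair R b' a a'

namespace IsMiyamotoQuad

variable {form : LinearMap.BilinForm R M} {a a' b b' : M} (H : IsMiyamotoQuad form a a' b b')
include H

theorem symm : IsMiyamotoQuad form b b' a a' :=
  ⟨H.axis_right, H.axis_right', H.axis_left, H.axis_left',
    H.pair_right, H.pair_right', H.pair_left, H.pair_left'⟩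

theorem flip : IsMiyamotoQuad form a' a b b' :=
  ⟨H.axis_left', H.axis_left, H.axis_right, H.axis_right',
    H.pair_left', H.pair_left, H.pair_right.symm, H.pair_right'.symm⟩

theorem dihedralInvariant_left : dihedralInvariant R a b = dihedralInvariant R a' b := by
  rw [dihedralInvariant_comm R, H.pair_right.dihedralInvariant_eq, dihedralInvariant_comm]

theorem add_mul_self : (b + b') * (b + b') = b + b' + (2 : R) • (b * b') := by
  rw [add_mul, mul_add, mul_add, H.axis_right.mul_self, H.axis_right'.mul_self, mul_comm b' b]
  module

theorem eight_smul_sub_mul_self [IsScalarTower R M M] :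
    (8 : R) • ((b + b' - (2 * form a b) • a) * (b + b' - (2 * form a b) • a)) =
      (8 - form a b) • (b + b') + (16 : R) • (b * b') +
      (-2 * form a b) • dihedralInvariant R a b +
      (32 * form a b ^ 2 - 2 * form a b) • a := by
  simp only [sub_mul, mul_sub, smul_mul_assoc, mul_smul_comm, H.axis_left.mul_self,
    H.add_mul_self, mul_comm (b + b') a]
  linear_combination (norm := module) (-form a b) • H.pair_left.mul_add_eq

variable (hform : ∀ u v w : M, form u (v * w) = form (u * v) w)
include hform

theorem form_left : form a b = form a' b := by
  rw [← H.axis_right.form_comm hform, H.pair_right.form_eq H.axis_right hform,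
    H.axis_right.form_comm hform]

theorem dihedralInvariant_mul_add : (32 : R) • (dihedralInvariant R a b * (b + b')) =
    (14 : R) • dihedralInvariant R a b + (768 * form a b - 25) • (b + b') +
      (7 : R) • (a + a') := by
  have hb := H.pair_right.mul_dihedralInvariant H.axis_right hform
  have hb' := H.pair_right'.mul_dihedralInvariant H.axis_right' hform
  rw [dihedralInvariant_comm R, ← H.axis_left.form_comm hform, mul_comm] at hb hb'
  rw [← H.pair_left.dihedralInvariant_eq, ← H.pair_left.form_eq H.axis_left hform] at hb'
  rw [← (isUnit_ofNat_of_algebra_real (R := R) 2).smul_left_cancel, mul_add]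
  linear_combination (norm := module) hb + hb'

theorem form_mul : 32 * form a (b * b') = 32 * form a b - 1 + form b b' := by
  have hS : (32 : R) • (a * b) = (32 : R) • (a * b') + b - b' := by
    have h := H.pair_left.dihedralInvariant_eq
    rw [dihedralInvariant, dihedralInvariant] at h
    linear_combination (norm := module) h
  have hab : form (a * b') b' = form a b := by
    rw [← hform, H.axis_right'.mul_self, H.pair_left.form_eq H.axis_left hform]
  rw [hform, ← smul_eq_mul, ← LinearMap.smul_apply, ← map_smul, hS]
  simp only [map_add, map_sub, map_smul, LinearMap.add_apply, LinearMap.sub_apply,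
    LinearMap.smul_apply, smul_eq_mul, hab, H.axis_right'.form_self]
  ring

theorem form_quarterPart_self :
    4 * form (quarterPart form a (b + b')) (quarterPart form a (b + b')) =
      64 * form a b - 64 * form a b ^ 2 - 1 + form b b' := by
  rw [H.axis_left.form_quarterPart_self hform H.pair_left.add_mem, H.add_mul_self, map_add,
    map_smul, H.pair_left.form_add_eq H.axis_left hform, smul_eq_mul]
  linear_combination H.form_mul hform

variable [IsScalarTower R M M]

theorem smul_mul_quarterPart : (128 : R) • ((b + b' - (2 * form a b) • a) *
      quarterPart form a (b + b')) =
    (16 - 80 * form a b) • dihedralInvariant R a b + (728 * form a b - 8) • (b + b') +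
      (2 - 80 * form a b + 512 * form a b ^ 2) • a + (7 : R) • (a + a') +
      (32 : R) • (b * b') := by
  have hq := H.pair_left.eight_smul_quarterPart H.axis_left hform
  have haq := mem_adEigenspace_quarter.1
    (H.axis_left.quarterPart_mem_and_sub_mem hform H.pair_left.add_mem).1
  have hVq := congrArg ((b + b') * ·) hq
  simp only [mul_add (b + b') (_ + _), mul_add (b + b') (_ • _), mul_smul_comm, H.add_mul_self,
    mul_comm (b + b') (dihedralInvariant R a b), mul_comm (b + b') a] at hVq
  rw [sub_mul, smul_mul_assoc]
  linear_combination (norm := module) (16 : R) • hVq + H.dihedralInvariant_mul_add hform +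
    (1 - 32 * form a b) • H.pair_left.mul_add_eq - (64 * form a b) • haq -
    (8 * form a b) • hq

/-- The first identity of the resurrection principle, solved for its only unknown product. -/
theorem mul_mul : (192 : R) • (a * (b * b')) =
    (64 * form a b - 2) • dihedralInvariant R a b +
      (320 * form a b - 2048 * form a b ^ 2 - 8 * form b b' - 8) • a +
      (32 * form a b - 1) • (b + b') + (14 : R) • (a * a') := by
  obtain ⟨hres, -⟩ := H.axis_left.resurrection hform H.pair_left.add_mem
    (congrArg (fun r ↦ b + b' - r • a) (H.pair_left.form_add_eq H.axis_left hform).symm) rfl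
  have hqq := H.axis_left.four_smul_mul_mul_self_of_mem_quarter hform
    (H.axis_left.quarterPart_mem_and_sub_mem hform H.pair_left.add_mem).1
  have hpp := congrArg (a * ·) (H.eight_smul_sub_mul_self)
  have hpq := congrArg (a * ·) (H.smul_mul_quarterPart hform)
  simp only [mul_add a (_ + _), mul_add a (_ • _), mul_add a a,
    mul_smul_comm, H.axis_left.mul_self] at hpp hpq
  have hqq' := congrArg (· • a) (H.form_quarterPart_self hform)
  have haS := H.pair_left.mul_dihedralInvariant H.axis_left hform
  have haV := H.pair_left.mul_add_eq
  rw [← (isUnit_ofNat_of_algebra_real (R := R) 2).smul_left_cancel]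
  linear_combination (norm := module) (256 : R) • hres - (32 : R) • hpp + (4 : R) • hpq
    - (64 : R) • hqq - (16 : R) • hqq' + (1 - 4 * form a b) • haS - (9 - 92 * form a b) • haV

theorem dihedralInvariant_mul_self :
    (96 : R) • (dihedralInvariant R a b * dihedralInvariant R a b) =
      (-1280 * form a b - 26) • dihedralInvariant R a b +
      (56 * (2048 * form a b ^ 2 - 32 * form a b + 8 * form b b' - 1)) • a +
      (63 : R) • (a + a') + (6272 * form a b - 133) • (b + b') +
      (336 : R) • (b * b') - (448 : R) • (a * a') := by
  obtain ⟨-, hres⟩ := H.axis_left.resurrection hform H.pair_left.add_mem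
    (congrArg (fun r ↦ b + b' - r • a) (H.pair_left.form_add_eq H.axis_left hform).symm) rfl
  have hq := H.axis_left.four_smul_mul_mul_self_of_mem_quarter hform
    (H.axis_left.quarterPart_mem_and_sub_mem hform H.pair_left.add_mem).1
  have hqform := congrArg (· • a) (H.form_quarterPart_self hform)
  have hpq := H.smul_mul_quarterPart hform
  have hapq := congrArg (a * ·) hpq
  have hqq := congrArg (fun w ↦ w * w) (H.pair_left.eight_smul_quarterPart H.axis_left hform)
  simp only [mul_add a (_ + _), mul_add a (_ • _), mul_add a a, mul_smul_comm,
    H.axis_left.mul_self] at hapq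
  simp only [smul_add_smul_add_mul_self, smul_mul_smul_comm, H.axis_left.mul_self,
    H.add_mul_self] at hqq
  have haS := H.pair_left.mul_dihedralInvariant H.axis_left hform
  have haV := H.pair_left.mul_add_eq
  have hSV := H.dihedralInvariant_mul_add hform
  linear_combination (norm := module) (1536 : R) • hres - (48 : R) • hapq + (1536 : R) • hq +
    (384 : R) • hqform + (12 : R) • hpq - (24 : R) • hqq - (15 - 156 * form a b) • haS -
    (996 * form a b - 9) • haV - (3 : R) • hSV - (8 : R) • H.mul_mul hform

/-- `a` and `a'` have the same dihedral invariant with `b`, but the formula for its square treats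
them differently. -/
theorem smul_sub_eq_zero :
    (56 * (2048 * form a b ^ 2 - 32 * form a b + 8 * form b b' - 1)) • (a - a') = 0 := by
  have hS := H.dihedralInvariant_mul_self hform
  have hS' := H.flip.dihedralInvariant_mul_self hform
  rw [← H.dihedralInvariant_left, ← H.form_left hform, mul_comm a' a] at hS'
  linear_combination (norm := module) hS' - hS

theorem form_relation_of_form_left (h : 8 * form a a' = 1) :
    2048 * form a b ^ 2 - 32 * form a b + 8 * form b b' - 1 = 0 := by
  have haa := congrArg (form a) (H.smul_sub_eq_zero hform)
  rw [map_smul, map_sub, H.axis_left.form_self, map_zero, smul_eq_mul] at haa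
  apply (isUnit_ofNat_of_algebra_real (R := R) 392).mul_right_eq_zero.1
  linear_combination 8 * haa +
    56 * (2048 * form a b ^ 2 - 32 * form a b + 8 * form b b' - 1) * h

section Determination

variable [IsDomain R] (h : 8 * form a a' = 1) (hb : b ≠ b')
include h hb

theorem form_right_eq : 8 * form b b' = 1 := by
  have hsmul : (56 * (1 - 8 * form b b')) • (b - b') = 0 := by
    rw [← H.symm.smul_sub_eq_zero hform, ← H.axis_left.form_comm hform]
    congr 1
    linear_combination (-56) * H.form_relation_of_form_left hform h - 56 * h
  have hprod : (1 - 8 * form b b') * (1 - form b b') = 0 := by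
    have hbb := congrArg (form b) hsmul
    rw [map_smul, map_sub, H.axis_right.form_self, map_zero, smul_eq_mul] at hbb
    apply (isUnit_ofNat_of_algebra_real (R := R) 56).mul_right_eq_zero.1
    rw [← mul_assoc, hbb]
  rcases mul_eq_zero.1 hprod with h8 | h1
  · exact (sub_eq_zero.1 h8).symm
  · refine absurd ((isUnit_ofNat_of_algebra_real (R := R) 392).smul_eq_zero.1 ?_) (sub_ne_zero.2 hb)
    rw [← neg_eq_zero, ← neg_smul, ← hsmul]
    congr 1
    linear_combination (-448) * h1

theorem smul_mul_sub_mul :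
    (4 : R) • (b * b') - (4 : R) • (a * a') = (32 * form a b - 1) • (a + a' - (b + b')) := by
  have hS := H.dihedralInvariant_mul_self hform
  have hS' := H.symm.dihedralInvariant_mul_self hform
  have hm := H.form_right_eq hform h hb
  have hL := H.form_relation_of_form_left hform h
  have ha : 2048 * form a b ^ 2 - 32 * form a b + 8 * form a a' - 1 = 0 := by
    linear_combination hL + h - hm
  rw [dihedralInvariant_comm R b a, ← H.axis_left.form_comm hform, ha] at hS'
  rw [hL] at hS
  rw [← (isUnit_ofNat_of_algebra_real (R := R) 196).smul_left_cancel]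
  linear_combination (norm := module) hS' - hS

theorem form_left_right_eq : 64 * form a b = 1 := by
  have hm := H.form_right_eq hform h hb
  have haa : form a (a * a') = form a a' := by rw [hform, H.axis_left.mul_self]
  have hT := congrArg (form a) (H.smul_mul_sub_mul hform h hb)
  simp only [map_sub, map_add, map_smul, smul_eq_mul, haa, H.axis_left.form_self,
    ← H.pair_left.form_eq H.axis_left hform] at hT
  have hprod : form a b * (64 * form a b - 1) = 0 := by
    apply (isUnit_ofNat_of_algebra_real (R := R) 32).mul_right_eq_zero.1
    linear_combination H.form_relation_of_form_left hform h - hm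
  rcases mul_eq_zero.1 hprod with h0 | h64
  · have h33 : (33 : R) = 0 := by
      linear_combination 64 * hT - 8 * H.form_mul hform - hm + 24 * h +
        (2048 * (1 + form a a' - 2 * form a b) - 128) * h0
    exact absurd h33 (isUnit_ofNat_of_algebra_real (R := R) 33).ne_zero
  · exact sub_eq_zero.1 h64

end Determination

variable [IsDomain R] {c : M} (h : IsDihedral2A form a a' c) (hb : b ≠ b')
include h hb

theorem eight_smul_mul_right : (8 : R) • (b * b') = b + b' - c := by
  have hT := H.smul_mul_sub_mul hform h.form_eq hb
  have hL := congrArg (· • (a + a' - (b + b'))) (H.form_left_right_eq hform h.form_eq hb)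
  linear_combination (norm := module) (2 : R) • hT + hL + h.mul_eq

theorem two_smul_dihedralInvariant :
    (2 : R) • dihedralInvariant R a b = c - (a + a') - (b + b') := by
  have hL := H.form_left_right_eq hform h.form_eq hb
  have hLS := congrArg (· • dihedralInvariant R a b) hL
  have hLV := congrArg (· • (b + b')) hL
  have hLa := congrArg (· • a) hL
  have hma := congrArg (· • a) (H.form_right_eq hform h.form_eq hb)
  have haT := congrArg (a * ·) (H.eight_smul_mul_right hform h hb)
  simp only [mul_sub, mul_smul_comm] at haT
  rw [← (isUnit_ofNat_of_algebra_real (R := R) 10).smul_left_cancel]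
  linear_combination (norm := module) (8 : R) • H.mul_mul hform - (192 : R) • haT -
    (6 : R) • H.pair_left.mul_add_eq + (24 : R) • h.mul_third + (14 : R) • h.mul_eq +
    (8 : R) • hLS + (4 : R) • hLV + (36 - 256 * form a b) • hLa - (8 : R) • hma

theorem mul_eq : (64 : R) • (a * b) = a + b - a' - b' + c := by
  have hS := H.two_smul_dihedralInvariant hform h hb
  rw [dihedralInvariant] at hS
  linear_combination (norm := module) hS

theorem mul_third_right : (8 : R) • (b * c) = b + c - b' := by
  have hS := H.two_smul_dihedralInvariant hform h hb
  have hbc := congrArg (b * ·) hS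
  have hLb := congrArg (· • b) (H.form_left_right_eq hform h.form_eq hb)
  have hbS := H.pair_right.mul_dihedralInvariant H.axis_right hform
  have hbA := H.pair_right.mul_add_eq
  rw [dihedralInvariant_comm R b a] at hbS hbA
  rw [← H.axis_left.form_comm hform] at hbS
  simp only [mul_sub b, mul_add b b, mul_smul_comm, H.axis_right.mul_self] at hbc
  rw [← (isUnit_ofNat_of_algebra_real (R := R) 4).smul_left_cancel]
  linear_combination (norm := module) hbS + hbA - (32 : R) • hbc +
    (4 : R) • H.eight_smul_mul_right hform h hb + (8 : R) • hS + (24 : R) • hLb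

theorem isDihedral2A_right : IsDihedral2A form b b' c where
  mul_eq := H.eight_smul_mul_right hform h hb
  mul_third := H.mul_third_right hform h hb
  mul_third' := H.symm.flip.symm.mul_third_right hform h hb.symm
  form_eq := H.form_right_eq hform h.form_eq hb

end IsMiyamotoQuad

end MiyamotoQuad

/-- The underlying space of the algebra of shape `4B` on the pairs of axes `a_{±i}`, `i : ι`: the
coordinates `φ i`, `δ i`, `γ` of a vector refer to `f i = (4 (a_i + a_{-i}) - a_ρ) / 5`,
`d i = a_i - a_{-i}` and `a_ρ`. The vectors `f i` and `a_ρ` are pairwise orthogonal idempotents. -/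
def Model4B (ι : Type*) : Type _ := (ι → ℝ) × (ι → ℝ) × ℝ

namespace Model4B

section Coordinates

variable {ι : Type*}

noncomputable instance : AddCommGroup (Model4B ι) :=
  inferInstanceAs (AddCommGroup ((ι → ℝ) × (ι → ℝ) × ℝ))

noncomputable instance : Module ℝ (Model4B ι) :=
  inferInstanceAs (Module ℝ ((ι → ℝ) × (ι → ℝ) × ℝ))

/-- The vector with given coordinates. -/
def mk (p d : ι → ℝ) (g : ℝ) : Model4B ι := (p, d, g)

/-- The coordinate at `f i`. -/
noncomputable def φ (i : ι) : Model4B ι →ₗ[ℝ] ℝ :=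
  LinearMap.proj i ∘ₗ LinearMap.fst ℝ (ι → ℝ) ((ι → ℝ) × ℝ)

/-- The coordinate at `d i`. -/
noncomputable def δ (i : ι) : Model4B ι →ₗ[ℝ] ℝ :=
  LinearMap.proj i ∘ₗ LinearMap.fst ℝ (ι → ℝ) ℝ ∘ₗ LinearMap.snd ℝ (ι → ℝ) ((ι → ℝ) × ℝ)

/-- The coordinate at `a_ρ`. -/
noncomputable def γ : Model4B ι →ₗ[ℝ] ℝ :=
  LinearMap.snd ℝ (ι → ℝ) ℝ ∘ₗ LinearMap.snd ℝ (ι → ℝ) ((ι → ℝ) × ℝ)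

@[simp] theorem φ_mk (p d : ι → ℝ) (g : ℝ) (i : ι) : φ i (mk p d g) = p i := rfl
@[simp] theorem δ_mk (p d : ι → ℝ) (g : ℝ) (i : ι) : δ i (mk p d g) = d i := rfl
@[simp] theorem γ_mk (p d : ι → ℝ) (g : ℝ) : γ (mk p d g) = g := rfl

@[ext] theorem ext {x y : Model4B ι} (hφ : ∀ i, φ i x = φ i y) (hδ : ∀ i, δ i x = δ i y)
    (hγ : γ x = γ y) : x = y :=
  Prod.ext (funext hφ) (Prod.ext (funext hδ) hγ)

variable [Fintype ι]

noncomputable instance : Mul (Model4B ι) where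
  mul x y := mk (fun i ↦ φ i x * φ i y + 15 / 16 * (δ i x * δ i y))
    (fun i ↦ 3 / 4 * (φ i x * δ i y + δ i x * φ i y) + 1 / 4 * (γ x * δ i y + δ i x * γ y))
    (γ x * γ y + 7 / 16 * ∑ i, δ i x * δ i y)

@[simp] theorem φ_mul (i : ι) (x y : Model4B ι) :
    φ i (x * y) = φ i x * φ i y + 15 / 16 * (δ i x * δ i y) := rfl

@[simp] theorem δ_mul (i : ι) (x y : Model4B ι) : δ i (x * y) =
    3 / 4 * (φ i x * δ i y + δ i x * φ i y) + 1 / 4 * (γ x * δ i y + δ i x * γ y) := rfl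

@[simp] theorem γ_mul (x y : Model4B ι) :
    γ (x * y) = γ x * γ y + 7 / 16 * ∑ i, δ i x * δ i y := rfl

noncomputable instance : NonUnitalNonAssocCommRing (Model4B ι) where
  left_distrib x y z := by
    ext <;> simp only [φ_mul, δ_mul, γ_mul, map_add, mul_add, Finset.sum_add_distrib] <;> ring
  right_distrib x y z := by
    ext <;> simp only [φ_mul, δ_mul, γ_mul, map_add, add_mul, Finset.sum_add_distrib] <;> ring
  zero_mul x := by ext <;> simp
  mul_zero x := by ext <;> simp
  mul_comm x y := by
    ext <;> simp only [φ_mul, δ_mul, γ_mul, mul_comm (φ _ x), mul_comm (δ _ x), mul_comm (γ x)]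
    ring

noncomputable instance : SMulCommClass ℝ (Model4B ι) (Model4B ι) where
  smul_comm r x y := by
    ext <;> simp only [map_smul, smul_eq_mul, φ_mul, δ_mul, γ_mul, mul_left_comm _ r,
      ← Finset.mul_sum] <;> ring

noncomputable instance : IsScalarTower ℝ (Model4B ι) (Model4B ι) where
  smul_assoc r x y := by
    ext <;> simp only [map_smul, smul_eq_mul, φ_mul, δ_mul, γ_mul, mul_assoc r,
      ← Finset.mul_sum] <;> ring

/-- The associating form. -/
noncomputable def form : LinearMap.BilinForm ℝ (Model4B ι) :=
  LinearMap.mk₂ ℝ (fun x y ↦ ∑ i, (7 / 5 * (φ i x * φ i y) + 7 / 4 * (δ i x * δ i y)) + γ x * γ y)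
    (fun x y z ↦ by
      simp only [map_add, add_mul, mul_add, Finset.sum_add_distrib]
      ring)
    (fun r x y ↦ by
      simp only [map_smul, smul_eq_mul, mul_add, Finset.mul_sum]
      congr 1
      · exact Finset.sum_congr rfl fun i _ ↦ by ring
      · ring)
    (fun x y z ↦ by
      simp only [map_add, mul_add, Finset.sum_add_distrib]
      ring)
    (fun r x y ↦ by
      simp only [map_smul, smul_eq_mul, mul_add, Finset.mul_sum]
      congr 1
      · exact Finset.sum_congr rfl fun i _ ↦ by ring
      · ring)

theorem form_apply (x y : Model4B ι) : form x y =
    ∑ i, (7 / 5 * (φ i x * φ i y) + 7 / 4 * (δ i x * δ i y)) + γ x * γ y := rfl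

theorem form_assoc (x y z : Model4B ι) : form x (y * z) = form (x * y) z := by
  simp only [form_apply, φ_mul, δ_mul, γ_mul, mul_add, add_mul, Finset.mul_sum, Finset.sum_mul,
    ← add_assoc]
  rw [add_right_comm, add_right_comm _ (γ x * γ y * γ z), ← Finset.sum_add_distrib,
    ← Finset.sum_add_distrib]
  congr 1
  · exact Finset.sum_congr rfl fun i _ ↦ by ring
  · ring

end Coordinates

section Vectors

variable {ι : Type*}

/-- The vector `a_ρ`. -/
def rho : Model4B ι := mk 0 0 1

@[simp] theorem φ_rho (i : ι) : φ i rho = 0 := rfl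
@[simp] theorem δ_rho (i : ι) : δ i rho = 0 := rfl
@[simp] theorem γ_rho : γ (rho : Model4B ι) = 1 := rfl

variable [DecidableEq ι]

/-- The axis `a_{±i}`, which is `(5 f i ± 4 d i + a_ρ) / 8`. -/
noncomputable def axis (p : ι × ℤˣ) : Model4B ι :=
  mk (Pi.single p.1 (5 / 8)) (Pi.single p.1 ((p.2 : ℤ) / 2)) (1 / 8)

@[simp] theorem φ_axis (p : ι × ℤˣ) (i : ι) : φ i (axis p) = if i = p.1 then 5 / 8 else 0 := by
  simp [axis, Pi.single_apply]

@[simp] theorem δ_axis (p : ι × ℤˣ) (i : ι) :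
    δ i (axis p) = if i = p.1 then ((p.2 : ℤ) / 2 : ℝ) else 0 := by
  simp [axis, Pi.single_apply]

@[simp] theorem γ_axis (p : ι × ℤˣ) : γ (axis p) = 1 / 8 := rfl

theorem axis_injective : Function.Injective (axis : ι × ℤˣ → Model4B ι) := by
  rintro ⟨i, e⟩ ⟨j, d⟩ h
  have hφ := congrArg (φ i) h
  have hij : i = j := by
    by_contra hij
    simp [hij] at hφ
  subst hij
  have hδ := congrArg (δ i) h
  simp only [δ_axis, if_true, div_left_inj' (two_ne_zero' ℝ), Int.cast_inj] at hδ
  rw [Units.ext hδ]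

end Vectors

section EigenCoordinates

variable {ι : Type*} (p : ι × ℤˣ)

/-- The coordinate at the axis `p`, in an eigenbasis of the adjoint map of `p`. -/
noncomputable def oneCoord : Model4B ι →ₗ[ℝ] ℝ :=
  (7 / 8 : ℝ) • φ p.1 + (7 / 8 * (p.2 : ℤ) : ℝ) • δ p.1 + (1 / 8 : ℝ) • γ

/-- The coordinate at the `0`-eigenvector `f i + a_ρ - a_{±i}` of the axis `p = a_{±i}`. -/
noncomputable def zeroCoord : Model4B ι →ₗ[ℝ] ℝ :=
  (3 / 8 : ℝ) • φ p.1 - (5 / 8 * (p.2 : ℤ) : ℝ) • δ p.1 + (5 / 8 : ℝ) • γ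

/-- The coordinate at the `1/4`-eigenvector `-5 f i ± 4 d i + 7 a_ρ` of the axis `p = a_{±i}`. -/
noncomputable def quarterCoord : Model4B ι →ₗ[ℝ] ℝ :=
  (1 / 16 : ℝ) • (-φ p.1 + ((p.2 : ℤ) : ℝ) • δ p.1 + γ)

theorem oneCoord_apply (x : Model4B ι) :
    oneCoord p x = 7 / 8 * φ p.1 x + 7 / 8 * (p.2 : ℤ) * δ p.1 x + 1 / 8 * γ x := rfl

theorem zeroCoord_apply (x : Model4B ι) :
    zeroCoord p x = 3 / 8 * φ p.1 x - 5 / 8 * (p.2 : ℤ) * δ p.1 x + 5 / 8 * γ x := rfl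

theorem quarterCoord_apply (x : Model4B ι) :
    quarterCoord p x = 1 / 16 * (-φ p.1 x + (p.2 : ℤ) * δ p.1 x + γ x) := rfl

theorem sign_mul_self (e : ℤˣ) : ((e : ℤ) : ℝ) * (e : ℤ) = 1 := by
  rcases Int.units_eq_one_or e with rfl | rfl <;> norm_num

theorem γ_eq (x : Model4B ι) :
    γ x = 1 / 8 * oneCoord p x + 7 / 8 * zeroCoord p x + 7 * quarterCoord p x := by
  rw [oneCoord_apply, zeroCoord_apply, quarterCoord_apply]
  ring

variable {p} in
theorem ext_eigenCoord {x y : Model4B ι} (h1 : oneCoord p x = oneCoord p y)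
    (h0 : zeroCoord p x = zeroCoord p y) (hq : quarterCoord p x = quarterCoord p y)
    (hφ : ∀ j ≠ p.1, φ j x = φ j y) (hδ : ∀ j ≠ p.1, δ j x = δ j y) : x = y := by
  have hγ : γ x = γ y := by rw [γ_eq p, γ_eq p y, h1, h0, hq]
  rw [oneCoord_apply, oneCoord_apply] at h1
  rw [quarterCoord_apply, quarterCoord_apply] at hq
  ext j
  · rcases eq_or_ne j p.1 with rfl | hj
    · linear_combination 4 / 7 * h1 - 8 * hq + 3 / 7 * hγ
    · exact hφ j hj
  · rcases eq_or_ne j p.1 with rfl | hj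
    · linear_combination (p.2 : ℤ) * (4 / 7 * h1 + 8 * hq - 4 / 7 * hγ) -
        (δ p.1 x - δ p.1 y) * sign_mul_self p.2
    · exact hδ j hj
  · exact hγ

variable [DecidableEq ι]

/-- The vector with given coordinates in an eigenbasis of the adjoint map of the axis `p`. -/
noncomputable def ofEigenCoord (α β κ : ℝ) (u v : ι → ℝ) : Model4B ι :=
  mk (Function.update u p.1 (5 / 8 * α + 3 / 8 * β - 5 * κ))
    (Function.update v p.1 ((p.2 : ℤ) * (1 / 2 * α - 1 / 2 * β + 4 * κ)))
    (1 / 8 * α + 7 / 8 * β + 7 * κ)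

variable {p}

@[simp] theorem oneCoord_ofEigenCoord (α β κ : ℝ) (u v : ι → ℝ) :
    oneCoord p (ofEigenCoord p α β κ u v) = α := by
  simp only [oneCoord_apply, ofEigenCoord, φ_mk, δ_mk, γ_mk, Function.update_self]
  linear_combination (7 / 16 * α - 7 / 16 * β + 7 / 2 * κ) * sign_mul_self p.2

@[simp] theorem zeroCoord_ofEigenCoord (α β κ : ℝ) (u v : ι → ℝ) :
    zeroCoord p (ofEigenCoord p α β κ u v) = β := by
  simp only [zeroCoord_apply, ofEigenCoord, φ_mk, δ_mk, γ_mk, Function.update_self]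
  linear_combination (-5 / 16 * α + 5 / 16 * β - 5 / 2 * κ) * sign_mul_self p.2

@[simp] theorem quarterCoord_ofEigenCoord (α β κ : ℝ) (u v : ι → ℝ) :
    quarterCoord p (ofEigenCoord p α β κ u v) = κ := by
  simp only [quarterCoord_apply, ofEigenCoord, φ_mk, δ_mk, γ_mk, Function.update_self]
  linear_combination (1 / 32 * α - 1 / 32 * β + 1 / 4 * κ) * sign_mul_self p.2

@[simp] theorem φ_ofEigenCoord (α β κ : ℝ) (u v : ι → ℝ) {j : ι} (hj : j ≠ p.1) :
    φ j (ofEigenCoord p α β κ u v) = u j := by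
  simp [ofEigenCoord, hj]

@[simp] theorem δ_ofEigenCoord (α β κ : ℝ) (u v : ι → ℝ) {j : ι} (hj : j ≠ p.1) :
    δ j (ofEigenCoord p α β κ u v) = v j := by
  simp [ofEigenCoord, hj]

variable [Fintype ι]

theorem oneCoord_mul (x y : Model4B ι) : oneCoord p (x * y) = oneCoord p x * oneCoord p y +
    28 * (quarterCoord p x * quarterCoord p y) +
    7 / 128 * ∑ j ∈ Finset.univ.erase p.1, δ j x * δ j y := by
  simp only [oneCoord_apply, quarterCoord_apply, φ_mul, δ_mul, γ_mul,
    ← Finset.add_sum_erase _ _ (Finset.mem_univ p.1)]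
  linear_combination (-7 / 8 * δ p.1 x * δ p.1 y) * sign_mul_self p.2

theorem zeroCoord_mul (x y : Model4B ι) : zeroCoord p (x * y) = zeroCoord p x * zeroCoord p y +
    60 * (quarterCoord p x * quarterCoord p y) +
    35 / 128 * ∑ j ∈ Finset.univ.erase p.1, δ j x * δ j y := by
  simp only [zeroCoord_apply, quarterCoord_apply, φ_mul, δ_mul, γ_mul,
    ← Finset.add_sum_erase _ _ (Finset.mem_univ p.1)]
  linear_combination (-5 / 8 * δ p.1 x * δ p.1 y) * sign_mul_self p.2

theorem quarterCoord_mul (x y : Model4B ι) : quarterCoord p (x * y) =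
    1 / 4 * (oneCoord p x * quarterCoord p y + quarterCoord p x * oneCoord p y) +
    3 / 4 * (zeroCoord p x * quarterCoord p y + quarterCoord p x * zeroCoord p y) +
    7 / 256 * ∑ j ∈ Finset.univ.erase p.1, δ j x * δ j y := by
  simp only [oneCoord_apply, zeroCoord_apply, quarterCoord_apply, φ_mul, δ_mul, γ_mul,
    ← Finset.add_sum_erase _ _ (Finset.mem_univ p.1)]
  linear_combination (1 / 32 * δ p.1 x * δ p.1 y) * sign_mul_self p.2

end EigenCoordinates

section Eigenspaces

open MonsterLabel hiding star

variable {ι : Type*} {p : ι × ℤˣ} {l m : MonsterLabel} {s : Set MonsterLabel} {x y : Model4B ι}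

/-- The eigen-coordinates of `x` for the axis `p` vanish at the labels outside of `s`. -/
structure IsSupportedOn (p : ι × ℤˣ) (s : Set MonsterLabel) (x : Model4B ι) : Prop where
  oneCoord_eq : one ∉ s → oneCoord p x = 0
  zeroCoord_eq : zero ∉ s → zeroCoord p x = 0
  φ_eq : zero ∉ s → ∀ j ≠ p.1, φ j x = 0
  quarterCoord_eq : quarter ∉ s → quarterCoord p x = 0
  δ_eq : thirtySecond ∉ s → ∀ j ≠ p.1, δ j x = 0

theorem IsSupportedOn.mul [Fintype ι] (hx : IsSupportedOn p {l} x)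
    (hy : IsSupportedOn p {m} y) : IsSupportedOn p (l.star m) (x * y) := by
  classical
  have hsum (h : thirtySecond ≠ l ∨ thirtySecond ≠ m) :
      ∑ j ∈ Finset.univ.erase p.1, δ j x * δ j y = 0 :=
    Finset.sum_eq_zero fun j hj ↦ by
      rcases h with h | h
      · rw [hx.δ_eq h j (Finset.ne_of_mem_erase hj), zero_mul]
      · rw [hy.δ_eq h j (Finset.ne_of_mem_erase hj), mul_zero]
  have hγx := γ_eq p x
  have hγy := γ_eq p y
  obtain ⟨h1, h2, h3, h4, h5⟩ := hx
  obtain ⟨k1, k2, k3, k4, k5⟩ := hy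
  cases l <;> cases m <;>
    simp only [Set.mem_singleton_iff, reduceCtorEq, not_true, not_false_eq_true, false_imp_iff,
      true_imp_iff, ne_eq, or_self, or_true, true_or] at * <;>
    constructor <;>
    simp +contextual [MonsterLabel.star, *, oneCoord_mul, zeroCoord_mul, quarterCoord_mul]

variable [DecidableEq ι]

theorem axis_eq_ofEigenCoord (p : ι × ℤˣ) : axis p = ofEigenCoord p 1 0 0 0 0 := by
  ext j
  · by_cases h : j = p.1 <;> simp [ofEigenCoord, h]
  · by_cases h : j = p.1 <;> simp [ofEigenCoord, h, div_eq_mul_inv]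
  · simp [ofEigenCoord]

theorem oneCoord_axis (p : ι × ℤˣ) : oneCoord p (axis p) = 1 := by
  rw [axis_eq_ofEigenCoord, oneCoord_ofEigenCoord]

/-- The component of `x` in the eigenspace of label `l` of the axis `p`. -/
noncomputable def component (p : ι × ℤˣ) (x : Model4B ι) : MonsterLabel → Model4B ι
  | one => ofEigenCoord p (oneCoord p x) 0 0 0 0
  | zero => ofEigenCoord p 0 (zeroCoord p x) 0 (fun j ↦ φ j x) 0
  | quarter => ofEigenCoord p 0 0 (quarterCoord p x) 0 0
  | thirtySecond => ofEigenCoord p 0 0 0 0 (fun j ↦ δ j x)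

theorem component_add (p : ι × ℤˣ) (x : Model4B ι) : component p x one + component p x zero +
    component p x quarter + component p x thirtySecond = x := by
  refine ext_eigenCoord (p := p) ?_ ?_ ?_ (fun j hj ↦ ?_) (fun j hj ↦ ?_)
  all_goals simp_all [component]

theorem IsSupportedOn.component_eq_zero (hx : IsSupportedOn p s x) (hl : l ∉ s) :
    component p x l = 0 := by
  cases l <;> refine ext_eigenCoord (p := p) ?_ ?_ ?_ (fun j hj ↦ ?_) (fun j hj ↦ ?_)
  all_goals simp_all [component, hx.oneCoord_eq, hx.zeroCoord_eq, hx.quarterCoord_eq, hx.φ_eq,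
    hx.δ_eq]

theorem component_one (p : ι × ℤˣ) (x : Model4B ι) :
    component p x one = oneCoord p x • axis p := by
  rw [axis_eq_ofEigenCoord]
  refine ext_eigenCoord (p := p) ?_ ?_ ?_ (fun j hj ↦ ?_) (fun j hj ↦ ?_)
  all_goals simp_all [component]

/-- The Miyamoto involution of the axes `a_{±i}`. -/
noncomputable def reflection (i : ι) : Model4B ι ≃ₗ[ℝ] Model4B ι :=
  LinearEquiv.ofInvolutive
    { toFun x := mk (fun j ↦ φ j x) (fun j ↦ if j = i then δ j x else -δ j x) (γ x)
      map_add' x y := by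
        ext j
        · simp
        · by_cases hj : j = i <;> simp [hj, add_comm]
        · simp
      map_smul' r x := by
        ext j
        · simp
        · by_cases hj : j = i <;> simp [hj]
        · simp }
    (fun x ↦ by
      ext j
      · simp
      · by_cases hj : j = i <;> simp [hj]
      · simp)

@[simp] theorem φ_reflection (i j : ι) (x : Model4B ι) : φ j (reflection i x) = φ j x := rfl

@[simp] theorem δ_reflection (i j : ι) (x : Model4B ι) :
    δ j (reflection i x) = if j = i then δ j x else -δ j x := rfl

@[simp] theorem γ_reflection (i : ι) (x : Model4B ι) : γ (reflection i x) = γ x := rfl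

@[simp] theorem oneCoord_reflection (p : ι × ℤˣ) (x : Model4B ι) :
    oneCoord p (reflection p.1 x) = oneCoord p x := by
  simp [oneCoord_apply]

@[simp] theorem zeroCoord_reflection (p : ι × ℤˣ) (x : Model4B ι) :
    zeroCoord p (reflection p.1 x) = zeroCoord p x := by
  simp [zeroCoord_apply]

@[simp] theorem quarterCoord_reflection (p : ι × ℤˣ) (x : Model4B ι) :
    quarterCoord p (reflection p.1 x) = quarterCoord p x := by
  simp [quarterCoord_apply]

variable [Fintype ι]

theorem axis_mul (p : ι × ℤˣ) (x : Model4B ι) : axis p * x =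
    ofEigenCoord p (one.val * oneCoord p x) (zero.val * zeroCoord p x)
      (quarter.val * quarterCoord p x) (fun j ↦ zero.val * φ j x)
      (fun j ↦ thirtySecond.val * δ j x) := by
  have hsum : ∑ j ∈ Finset.univ.erase p.1, δ j (axis p) * δ j x = 0 :=
    Finset.sum_eq_zero fun j hj ↦ by simp [Finset.ne_of_mem_erase hj]
  have hγ : γ (axis p) = 1 / 8 := γ_axis p
  rw [axis_eq_ofEigenCoord] at *
  refine ext_eigenCoord (p := p) ?_ ?_ ?_ (fun j hj ↦ ?_) (fun j hj ↦ ?_)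
  · simp [val, oneCoord_mul, hsum]
  · simp [val, zeroCoord_mul, hsum]
  · simp [val, quarterCoord_mul, hsum]
  · simp [val, hj]
  · simp only [δ_mul, φ_ofEigenCoord _ _ _ _ _ hj, δ_ofEigenCoord _ _ _ _ _ hj, hγ, val,
      Pi.zero_apply]
    ring

theorem mem_adEigenspace_axis : x ∈ adEigenspace ℝ (axis p) l ↔ IsSupportedOn p {l} x := by
  have val_mul_eq {k : MonsterLabel} {r : ℝ} :
      k.val * r = l.val * r ↔ (k ∉ ({l} : Set MonsterLabel) → r = 0) := by
    rw [mul_eq_mul_right_iff, val_injective.eq_iff, Set.mem_singleton_iff, or_iff_not_imp_left]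
  rw [mem_adEigenspace, axis_mul, Algebra.algebraMap_self_apply]
  constructor
  · intro h
    refine ⟨val_mul_eq.1 ?_, val_mul_eq.1 ?_, fun hl j hj ↦ val_mul_eq.1 ?_ hl, val_mul_eq.1 ?_,
      fun hl j hj ↦ val_mul_eq.1 ?_ hl⟩
    · simpa using congrArg (oneCoord p) h
    · simpa using congrArg (zeroCoord p) h
    · simpa [hj] using congrArg (φ j) h
    · simpa using congrArg (quarterCoord p) h
    · simpa [hj] using congrArg (δ j) h
  · intro h
    refine ext_eigenCoord (p := p) ?_ ?_ ?_ (fun j hj ↦ ?_) (fun j hj ↦ ?_)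
    · simpa using val_mul_eq.2 h.oneCoord_eq
    · simpa using val_mul_eq.2 h.zeroCoord_eq
    · simpa using val_mul_eq.2 h.quarterCoord_eq
    · simpa [hj] using val_mul_eq.2 fun hl ↦ h.φ_eq hl j hj
    · simpa [hj] using val_mul_eq.2 fun hl ↦ h.δ_eq hl j hj

theorem component_mem (p : ι × ℤˣ) (x : Model4B ι) (l : MonsterLabel) :
    component p x l ∈ adEigenspace ℝ (axis p) l := by
  rw [mem_adEigenspace_axis]
  cases l <;> constructor <;> simp +contextual [component]

theorem axis_mem_adEigenspace_one (p : ι × ℤˣ) :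
    (axis p : Model4B ι) ∈ adEigenspace ℝ (axis p) one := by
  simpa only [component_one, oneCoord_axis, one_smul] using component_mem p (axis p) one

theorem isPrimitiveAxis (p : ι × ℤˣ) : IsPrimitiveAxis ℝ (axis p : Model4B ι) := by
  apply le_antisymm
  · intro x hx
    have hsupp := mem_adEigenspace_axis.1 hx
    have hx1 : oneCoord p x • axis p = x := by
      conv_rhs => rw [← component_add p x, hsupp.component_eq_zero (l := zero) (by simp),
        hsupp.component_eq_zero (l := quarter) (by simp),
        hsupp.component_eq_zero (l := thirtySecond) (by simp), component_one]
      simp only [add_zero]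
    exact Submodule.mem_span_singleton.2 ⟨_, hx1⟩
  · exact (Submodule.span_singleton_le_iff_mem _ _).2 (axis_mem_adEigenspace_one p)

theorem IsSupportedOn.mem_adEigenspaces (hx : IsSupportedOn p s x) :
    x ∈ adEigenspaces ℝ (axis p) s := by
  have hmem (l : MonsterLabel) : component p x l ∈ adEigenspaces ℝ (axis p) s := by
    by_cases hl : l ∈ s
    · exact adEigenspace_le_adEigenspaces _ hl (component_mem p x l)
    · rw [hx.component_eq_zero hl]
      exact zero_mem _
  rw [← component_add p x]
  exact add_mem (add_mem (add_mem (hmem _) (hmem _)) (hmem _)) (hmem _)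

theorem isMonsterAxis (p : ι × ℤˣ) : IsMonsterAxis ℝ (axis p : Model4B ι) where
  idem := mem_adEigenspace_one.1 (axis_mem_adEigenspace_one p)
  semisimple := by
    rw [DirectSum.isInternal_submodule_iff_iSupIndep_and_iSup_eq_top, ← adEigenspaces_univ]
    refine ⟨(Module.End.eigenspaces_iSupIndep _).comp val_injective, ?_⟩
    rw [eq_top_iff]
    rintro x -
    apply IsSupportedOn.mem_adEigenspaces
    constructor <;> simp
  fusion l m x hx y hy :=
    ((mem_adEigenspace_axis.1 hx).mul (mem_adEigenspace_axis.1 hy)).mem_adEigenspaces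

theorem isMiyamotoInvolution (p : ι × ℤˣ) :
    IsMiyamotoInvolution ℝ (axis p) (reflection p.1) where
  map_even v hv := by
    have hle : adEigenspaces ℝ (axis p) {.one, .zero, .quarter} ≤
        LinearMap.eqLocus (reflection p.1).toLinearMap LinearMap.id := by
      refine iSup₂_le fun l hl x hx ↦ ?_
      have hδ := (mem_adEigenspace_axis.1 hx).δ_eq (by rintro rfl; simp at hl)
      change reflection p.1 x = x
      ext j
      · simp
      · by_cases hj : j = p.1 <;> simp [hj, hδ]
      · simp
    exact hle hv
  map_odd v hv := by
    have hv := mem_adEigenspace_axis.1 hv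
    have h1 := hv.oneCoord_eq (by simp)
    have h0 := hv.zeroCoord_eq (by simp)
    have hq := hv.quarterCoord_eq (by simp)
    have hφ := hv.φ_eq (by simp)
    refine ext_eigenCoord (p := p) ?_ ?_ ?_ (fun j hj ↦ ?_) (fun j hj ↦ ?_)
    · simp [h1]
    · simp [h0]
    · simp [hq]
    · simp [hφ j hj]
    · simp [hj]

end Eigenspaces

theorem reflection_axis (p q : AxisIndex) : reflection p.1 (axis q) = axis (axisPerm p q) := by
  by_cases hq : q.1 = p.1
  · ext j
    · simp [axisPerm, hq]
    · by_cases hj : j = p.1 <;> simp [axisPerm, hq, hj]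
    · simp
  · ext j
    · simp [axisPerm, hq]
    · by_cases hj : j = q.1 <;> simp [axisPerm, hq, hj, neg_div]
    · simp

end Model4B

section Table

/-- The values of the products and of the form on the axes `gen (i, ±1) = a_{±i}` and the vector
`c = a_ρ` in an algebra of shape `4B`. -/
structure IsTable4B {ι R M : Type*} [CommRing R] [NonUnitalNonAssocCommRing M] [Module R M]
    (form : LinearMap.BilinForm R M) (gen : ι × ℤˣ → M) (c : M) : Prop where
  mul_self : ∀ p, gen p * gen p = gen p
  third_mul_self : c * c = c
  pair : ∀ i e, IsDihedral2A form (gen (i, e)) (gen (i, -e)) c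
  mul_of_ne : ∀ {i j}, i ≠ j → ∀ e d, (64 : R) • (gen (i, e) * gen (j, d)) =
    gen (i, e) + gen (j, d) - gen (i, -e) - gen (j, -d) + c
  form_self : ∀ p, form (gen p) (gen p) = 1
  form_third_self : form c c = 1
  form_third_right : ∀ p, 8 * form (gen p) c = 1
  form_third_left : ∀ p, 8 * form c (gen p) = 1
  form_of_ne : ∀ {i j}, i ≠ j → ∀ e d, 64 * form (gen (i, e)) (gen (j, d)) = 1

theorem eq_or_eq_neg_or_fst_ne {ι : Type*} (p q : ι × ℤˣ) :
    q = p ∨ q = (p.1, -p.2) ∨ p.1 ≠ q.1 := by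
  rcases eq_or_ne p.1 q.1 with h | h
  · rcases eq_or_ne p.2 q.2 with h' | h'
    · exact .inl (Prod.ext h.symm h'.symm)
    · exact .inr (.inl (Prod.ext h.symm (Int.units_ne_iff_eq_neg.1 h'.symm)))
  · exact .inr (.inr h)

section Semilinear

variable {R R' M M' : Type*} [CommRing R] [CommRing R'] {σ : R →+* R'}

theorem map_eq_of_ofNat_smul_eq [Algebra ℝ R'] [AddCommGroup M] [AddCommGroup M'] [Module R M]
    [Module R' M'] (F : M →ₛₗ[σ] M') {n : ℕ} [n.AtLeastTwo] {x y : M} {x' : M'}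
    (h : (OfNat.ofNat n : R) • x = y) (h' : (OfNat.ofNat n : R') • x' = F y) : F x = x' := by
  rw [← (isUnit_ofNat_of_algebra_real (R := R') n).smul_left_cancel, h', ← h, map_smulₛₗ,
    map_ofNat]

theorem map_eq_of_ofNat_mul_eq_one [Algebra ℝ R'] {n : ℕ} [n.AtLeastTwo] {r : R} {r' : R'}
    (h : OfNat.ofNat n * r = 1) (h' : OfNat.ofNat n * r' = 1) : r' = σ r :=
  (map_eq_of_ofNat_smul_eq σ.toSemilinearMap (n := n) h (h'.trans (map_one σ).symm)).symm

/-- The semilinear map with prescribed values on a finite basis. -/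
noncomputable def semilinearExtension [AddCommGroup M] [AddCommGroup M'] [Module R M]
    [Module R' M'] {κ : Type*} [Fintype κ] (σ : R →+* R') (b : Module.Basis κ R M)
    (v : κ → M') : M →ₛₗ[σ] M' where
  toFun x := ∑ k, σ (b.repr x k) • v k
  map_add' x y := by simp [add_smul, Finset.sum_add_distrib]
  map_smul' r x := by simp [mul_smul, Finset.smul_sum]

theorem semilinearExtension_apply_basis [AddCommGroup M] [AddCommGroup M'] [Module R M]
    [Module R' M'] {κ : Type*} [Fintype κ] (σ : R →+* R') (b : Module.Basis κ R M)
    (v : κ → M') (k : κ) : semilinearExtension σ b v (b k) = v k := by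
  classical
  simp [semilinearExtension, Finsupp.single_apply, apply_ite σ, ite_smul]

end Semilinear

namespace IsTable4B

variable {ι R M : Type*} [CommRing R] [NonUnitalNonAssocCommRing M] [Module R M]
  {form : LinearMap.BilinForm R M} {gen : ι × ℤˣ → M} {c : M} (T : IsTable4B form gen c)
include T

section Map

variable {R' M' : Type*} [CommRing R'] [Algebra ℝ R'] [NonUnitalNonAssocCommRing M'] [Module R' M']
  {form' : LinearMap.BilinForm R' M'} {gen' : ι × ℤˣ → M'} {c' : M'} (T' : IsTable4B form' gen' c')
  {σ : R →+* R'} {F : M →ₛₗ[σ] M'} (hgen : ∀ p, F (gen p) = gen' p) (hc : F c = c')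
include T' hgen hc

theorem map_mul_of_mem {k l : M} (hk : k ∈ insert c (Set.range gen))
    (hl : l ∈ insert c (Set.range gen)) : F (k * l) = F k * F l := by
  have map_gen_mul_third (p) : F (gen p * c) = gen' p * c' :=
    map_eq_of_ofNat_smul_eq F (T.pair p.1 p.2).mul_third <| by
      rw [(T'.pair p.1 p.2).mul_third, map_sub, map_add, hgen, hgen, hc]
  rcases hk with rfl | ⟨p, rfl⟩ <;> rcases hl with rfl | ⟨q, rfl⟩
  · rw [T.third_mul_self, hc, T'.third_mul_self]
  · rw [mul_comm, map_gen_mul_third, hc, hgen, mul_comm]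
  · rw [map_gen_mul_third, hc, hgen]
  · rw [hgen, hgen]
    rcases eq_or_eq_neg_or_fst_ne p q with rfl | rfl | hpq
    · rw [T.mul_self, hgen, T'.mul_self]
    · refine map_eq_of_ofNat_smul_eq F (T.pair p.1 p.2).mul_eq ?_
      rw [(T'.pair p.1 p.2).mul_eq, map_sub, map_add, hgen, hgen, hc]
    · refine map_eq_of_ofNat_smul_eq F (T.mul_of_ne hpq p.2 q.2) ?_
      rw [T'.mul_of_ne hpq p.2 q.2]
      simp only [map_sub, map_add, hgen, hc]

theorem map_form_of_mem {k l : M} (hk : k ∈ insert c (Set.range gen))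
    (hl : l ∈ insert c (Set.range gen)) : form' (F k) (F l) = σ (form k l) := by
  rcases hk with rfl | ⟨p, rfl⟩ <;> rcases hl with rfl | ⟨q, rfl⟩ <;> simp only [hgen, hc]
  · rw [T.form_third_self, T'.form_third_self, map_one]
  · exact map_eq_of_ofNat_mul_eq_one (T.form_third_left q) (T'.form_third_left q)
  · exact map_eq_of_ofNat_mul_eq_one (T.form_third_right p) (T'.form_third_right p)
  · rcases eq_or_eq_neg_or_fst_ne p q with rfl | rfl | hpq
    · rw [T.form_self, T'.form_self, map_one]
    · exact map_eq_of_ofNat_mul_eq_one (T.pair p.1 p.2).form_eq (T'.pair p.1 p.2).form_eq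
    · exact map_eq_of_ofNat_mul_eq_one (T.form_of_ne hpq p.2 q.2) (T'.form_of_ne hpq p.2 q.2)

variable (hspan : Submodule.span R (insert c (Set.range gen)) = ⊤)
include hspan

theorem map_mul [SMulCommClass R M M] [IsScalarTower R M M] [SMulCommClass R' M' M']
    [IsScalarTower R' M' M'] (x y : M) : F (x * y) = F x * F y := by
  have hx : x ∈ Submodule.span R (insert c (Set.range gen)) := hspan ▸ Submodule.mem_top
  have hy : y ∈ Submodule.span R (insert c (Set.range gen)) := hspan ▸ Submodule.mem_top
  induction hx, hy using Submodule.span_induction₂ with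
  | mem_mem x y hx hy => exact T.map_mul_of_mem T' hgen hc hx hy
  | zero_left => simp
  | zero_right => simp
  | add_left x y z _ _ _ h₁ h₂ => rw [add_mul, map_add, h₁, h₂, map_add, add_mul]
  | add_right x y z _ _ _ h₁ h₂ => rw [mul_add, map_add, h₁, h₂, map_add, mul_add]
  | smul_left r x y _ _ h => rw [smul_mul_assoc, map_smulₛₗ, h, map_smulₛₗ, smul_mul_assoc]
  | smul_right r x y _ _ h => rw [mul_smul_comm, map_smulₛₗ, h, map_smulₛₗ, mul_smul_comm]

theorem map_form (x y : M) : form' (F x) (F y) = σ (form x y) := by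
  have hx : x ∈ Submodule.span R (insert c (Set.range gen)) := hspan ▸ Submodule.mem_top
  have hy : y ∈ Submodule.span R (insert c (Set.range gen)) := hspan ▸ Submodule.mem_top
  induction hx, hy using Submodule.span_induction₂ with
  | mem_mem x y hx hy => exact T.map_form_of_mem T' hgen hc hx hy
  | zero_left => simp
  | zero_right => simp
  | add_left _ _ _ _ _ _ h₁ h₂ => simp [h₁, h₂]
  | add_right _ _ _ _ _ _ h₁ h₂ => simp [h₁, h₂]
  | smul_left _ _ _ _ _ h => simp [h]
  | smul_right _ _ _ _ _ h => simp [h]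

end Map

section Subalgebra

theorem third_mem {S : NonUnitalSubalgebra R M} {i : ι} {e : ℤˣ} (h : gen (i, e) ∈ S)
    (h' : gen (i, -e) ∈ S) : c ∈ S := by
  have hc : c = gen (i, e) + gen (i, -e) - (8 : R) • (gen (i, e) * gen (i, -e)) := by
    rw [(T.pair i e).mul_eq, sub_sub_cancel]
  rw [hc]
  exact sub_mem (add_mem h h') (SMulMemClass.smul_mem _ (mul_mem h h'))

variable [Algebra ℝ R]

theorem mul_mem_span_of_mem (s : Set ι) {k l : M} (hk : k ∈ insert c (gen '' (Prod.fst ⁻¹' s)))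
    (hl : l ∈ insert c (gen '' (Prod.fst ⁻¹' s))) :
    k * l ∈ Submodule.span R (insert c (gen '' (Prod.fst ⁻¹' s))) := by
  set N := Submodule.span R (insert c (gen '' (Prod.fst ⁻¹' s)))
  have hc : c ∈ N := Submodule.subset_span (Set.mem_insert _ _)
  have hgen {p} (hp : p.1 ∈ s) : gen p ∈ N :=
    Submodule.subset_span (Set.mem_insert_of_mem _ (Set.mem_image_of_mem gen hp))
  have cancel (n : ℕ) [n.AtLeastTwo] {x y : M} (h : (OfNat.ofNat n : R) • x = y) (hy : y ∈ N) :
      x ∈ N :=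
    (N.smul_mem_iff_of_isUnit (isUnit_ofNat_of_algebra_real (R := R) n)).1 (h ▸ hy)
  have gen_mul_third {p} (hp : p.1 ∈ s) : gen p * c ∈ N :=
    cancel 8 (T.pair p.1 p.2).mul_third (sub_mem (add_mem (hgen hp) hc) (hgen hp))
  rcases hk with rfl | ⟨p, hp, rfl⟩ <;> rcases hl with rfl | ⟨q, hq, rfl⟩
  · exact T.third_mul_self.symm ▸ hc
  · exact mul_comm k (gen q) ▸ gen_mul_third hq
  · exact gen_mul_third hp
  · rcases eq_or_eq_neg_or_fst_ne p q with rfl | rfl | hpq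
    · exact (T.mul_self q).symm ▸ hgen hq
    · exact cancel 8 (T.pair p.1 p.2).mul_eq (sub_mem (add_mem (hgen hp) (hgen hp)) hc)
    · exact cancel 64 (T.mul_of_ne hpq p.2 q.2)
        (add_mem (sub_mem (sub_mem (add_mem (hgen hp) (hgen hq)) (hgen hp)) (hgen hq)) hc)

theorem gen_neg_mem {S : NonUnitalSubalgebra R M} {i j : ι} (hij : i ≠ j) {e d : ℤˣ}
    (ha : gen (i, e) ∈ S) (hb : gen (j, d) ∈ S) : gen (j, -d) ∈ S := by
  set u : M := (64 : R) • (gen (i, e) * gen (j, d)) - gen (i, e) - gen (j, d) with hu_def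
  have hu : u ∈ S := sub_mem (sub_mem (SMulMemClass.smul_mem _ (mul_mem ha hb)) ha) hb
  have hu_eq : u = c - gen (i, -e) - gen (j, -d) := by
    rw [hu_def, T.mul_of_ne hij]
    module
  have hau : (64 : R) • (gen (i, e) * u) = (15 : R) • (c - gen (i, -e)) - gen (j, -d) +
      gen (j, d) - gen (i, e) := by
    have hmul := T.mul_of_ne hij e (-d)
    rw [neg_neg] at hmul
    rw [hu_eq, mul_sub, mul_sub]
    linear_combination (norm := module) (8 : R) • (T.pair i e).mul_third -
      (8 : R) • (T.pair i e).mul_eq - hmul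
  have h14 : (14 : R) • gen (j, -d) =
      (64 : R) • (gen (i, e) * u) - gen (j, d) + gen (i, e) - (15 : R) • u := by
    rw [hau, hu_eq]
    module
  have h14_mem : (14 : R) • gen (j, -d) ∈ S := by
    rw [h14]
    exact sub_mem (add_mem (sub_mem (SMulMemClass.smul_mem _ (mul_mem ha hu)) hb) ha)
      (SMulMemClass.smul_mem _ hu)
  exact (S.toSubmodule.smul_mem_iff_of_isUnit (isUnit_ofNat_of_algebra_real (R := R) 14)).1 h14_mem

variable [SMulCommClass R M M] [IsScalarTower R M M]

theorem mul_mem_span (s : Set ι) {x y : M}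
    (hx : x ∈ Submodule.span R (insert c (gen '' (Prod.fst ⁻¹' s))))
    (hy : y ∈ Submodule.span R (insert c (gen '' (Prod.fst ⁻¹' s)))) :
    x * y ∈ Submodule.span R (insert c (gen '' (Prod.fst ⁻¹' s))) := by
  induction hx, hy using Submodule.span_induction₂ with
  | mem_mem x y hx hy => exact T.mul_mem_span_of_mem s hx hy
  | zero_left => simp
  | zero_right => simp
  | add_left x y z _ _ _ h₁ h₂ => exact add_mul x y z ▸ add_mem h₁ h₂
  | add_right x y z _ _ _ h₁ h₂ => exact mul_add x y z ▸ add_mem h₁ h₂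
  | smul_left r x y _ _ h => exact smul_mul_assoc r x y ▸ Submodule.smul_mem _ r h
  | smul_right r x y _ _ h => exact mul_smul_comm r x y ▸ Submodule.smul_mem _ r h

theorem adjoin_le_span (s : Set ι) :
    (NonUnitalAlgebra.adjoin R (gen '' (Prod.fst ⁻¹' s))).toSubmodule ≤
      Submodule.span R (insert c (gen '' (Prod.fst ⁻¹' s))) := by
  let S : NonUnitalSubalgebra R M :=
    { Submodule.span R (insert c (gen '' (Prod.fst ⁻¹' s))) with mul_mem' := T.mul_mem_span s }
  exact NonUnitalAlgebra.adjoin_le (S := S)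
    fun x hx ↦ Submodule.subset_span (Set.mem_insert_of_mem c hx)

theorem adjoin_pair_eq_span {i j : ι} (hij : i ≠ j) :
    (NonUnitalAlgebra.adjoin R {gen (i, 1), gen (j, 1)}).toSubmodule =
      Submodule.span R (insert c (gen '' (Prod.fst ⁻¹' {i, j}))) := by
  apply le_antisymm
  · refine le_trans ?_ (T.adjoin_le_span {i, j})
    refine NonUnitalAlgebra.adjoin_mono (Set.pair_subset ?_ ?_)
    · exact ⟨(i, 1), .inl rfl, rfl⟩
    · exact ⟨(j, 1), .inr rfl, rfl⟩
  · set S := NonUnitalAlgebra.adjoin R {gen (i, 1), gen (j, 1)}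
    have hi : gen (i, 1) ∈ S := NonUnitalAlgebra.subset_adjoin R (Set.mem_insert _ _)
    have hj : gen (j, 1) ∈ S := NonUnitalAlgebra.subset_adjoin R (Set.mem_insert_of_mem _ rfl)
    have hi' : gen (i, -1) ∈ S := T.gen_neg_mem hij.symm hj hi
    have hj' : gen (j, -1) ∈ S := T.gen_neg_mem hij hi hj
    rw [Submodule.span_le]
    rintro _ (rfl | ⟨⟨k, e⟩, rfl | rfl, rfl⟩)
    · exact T.third_mem hi hi'
    · rcases Int.units_eq_one_or e with rfl | rfl <;> assumption
    · rcases Int.units_eq_one_or e with rfl | rfl <;> assumption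

theorem isDihedral4B {i j : ι} (hij : i ≠ j)
    (hLI : LinearIndependent R ![gen (j, -1), gen (i, 1), gen (j, 1), gen (i, -1), c]) :
    IsDihedral4B R form (gen (i, 1)) (gen (j, 1)) (gen (j, -1)) (gen (i, -1)) := by
  have eq_one_div {n : ℕ} [n.AtLeastTwo] {r : R} (h : OfNat.ofNat n * r = 1) :
      r = algebraMap ℝ R (1 / OfNat.ofNat n) :=
    map_eq_of_ofNat_mul_eq_one (mul_one_div_cancel (OfNat.ofNat_ne_zero n)) h
  have hspan : ({gen (j, -1), gen (i, 1), gen (j, 1), gen (i, -1), c} : Set M) =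
      insert c (gen '' (Prod.fst ⁻¹' {i, j})) := by
    have hpre : (Prod.fst ⁻¹' {i, j} : Set (ι × ℤˣ)) = {(j, -1), (i, 1), (j, 1), (i, -1)} := by
      ext ⟨k, e⟩
      rcases Int.units_eq_one_or e with rfl | rfl <;> simp [or_comm]
    rw [hpre]
    simp only [Set.image_insert_eq, Set.image_singleton]
    aesop
  have hmul (e d : ℤˣ) : (64 : R) • (gen (i, e) * gen (j, d)) =
      gen (i, e) + gen (j, d) - gen (j, -d) - gen (i, -e) + c := by
    rw [T.mul_of_ne hij, sub_right_comm (gen (i, e) + gen (j, d))]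
  have hi (e : ℤˣ) := T.pair i e
  have hj (e : ℤˣ) := T.pair j e
  have hform (e d : ℤˣ) := eq_one_div (T.form_of_ne hij e d)
  have hthird (p : ι × ℤˣ) := eq_one_div (T.form_third_right p)
  refine ⟨c, hLI, by rw [hspan, T.adjoin_pair_eq_span hij], ?_, ?_, ?_, ?_, ?_, ?_⟩
  · simp [T.mul_self, T.third_mul_self]
  · exact ⟨hmul 1 1, hmul 1 (-1), hmul (-1) 1, hmul (-1) (-1)⟩
  · exact ⟨(hi 1).mul_eq, (hj 1).mul_eq, (hi 1).mul_third, (hi 1).mul_third', (hj 1).mul_third,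
      (hj 1).mul_third'⟩
  · simp only [T.form_self, T.form_third_self, and_self]
  · exact ⟨hform 1 1, hform 1 (-1), hform (-1) 1, hform (-1) (-1)⟩
  · exact ⟨eq_one_div (hi 1).form_eq, eq_one_div (hj 1).form_eq, hthird _, hthird _, hthird _,
      hthird _⟩

end Subalgebra

end IsTable4B

end Table

namespace Model4B

section Universal

variable {ι : Type*} [Fintype ι]

theorem form_self_eq_zero {x : Model4B ι} (h : form x x = 0) : x = 0 := by
  have hnonneg (i : ι) : 0 ≤ 7 / 5 * (φ i x * φ i x) + 7 / 4 * (δ i x * δ i x) := by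
    have := mul_self_nonneg (φ i x)
    have := mul_self_nonneg (δ i x)
    positivity
  rw [form_apply, add_eq_zero_iff_of_nonneg (Finset.sum_nonneg fun i _ ↦ hnonneg i)
    (mul_self_nonneg _), Finset.sum_eq_zero_iff_of_nonneg fun i _ ↦ hnonneg i] at h
  ext i
  · have := h.1 i (Finset.mem_univ i)
    exact mul_self_eq_zero.1 (by linarith [mul_self_nonneg (φ i x), mul_self_nonneg (δ i x)])
  · have := h.1 i (Finset.mem_univ i)
    exact mul_self_eq_zero.1 (by linarith [mul_self_nonneg (φ i x), mul_self_nonneg (δ i x)])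
  · exact mul_self_eq_zero.1 h.2

theorem rho_mul_self : (rho * rho : Model4B ι) = rho := by
  ext <;> simp

variable [DecidableEq ι]

theorem form_axis_left (p : ι × ℤˣ) (x : Model4B ι) : form (axis p) x = oneCoord p x := by
  simp only [form_apply, oneCoord_apply, φ_axis, δ_axis, γ_axis, ite_mul, zero_mul, mul_ite,
    mul_zero, Finset.sum_add_distrib, Finset.sum_ite_eq', Finset.mem_univ, if_true]
  ring

theorem eight_smul_axis_mul_rho (i : ι) (e : ℤˣ) :
    (8 : ℝ) • (axis (i, e) * rho) = axis (i, e) + rho - axis (i, -e) := by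
  ext j
  · simp
  · by_cases h : j = i
    · simp only [h, map_smul, map_add, map_sub, smul_eq_mul, δ_mul, φ_axis, δ_axis, γ_axis, φ_rho,
        δ_rho, γ_rho, if_true, Units.val_neg, Int.cast_neg]
      ring
    · simp [h]
  · simp

theorem isDihedral2A (i : ι) (e : ℤˣ) : IsDihedral2A form (axis (i, e)) (axis (i, -e)) rho where
  mul_eq := by
    have he := sign_mul_self e
    ext j
    · by_cases h : j = i
      · simp only [h, map_smul, map_add, map_sub, smul_eq_mul, φ_mul, φ_axis, δ_axis, φ_rho,
          if_true, Units.val_neg, Int.cast_neg]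
        linear_combination (-15 / 8) * he
      · simp [h]
    · by_cases h : j = i
      · simp only [h, map_smul, map_add, map_sub, smul_eq_mul, δ_mul, φ_axis, δ_axis, γ_axis,
          δ_rho, if_true, Units.val_neg, Int.cast_neg]
        ring
      · simp [h]
    · simp only [map_smul, map_add, map_sub, smul_eq_mul, γ_mul, γ_axis, γ_rho, δ_axis, mul_ite,
        mul_zero, Finset.sum_ite_eq', Finset.mem_univ, if_true, Units.val_neg, Int.cast_neg]
      linear_combination (-7 / 8) * he
  mul_third := eight_smul_axis_mul_rho i e
  mul_third' := by simpa only [neg_neg] using eight_smul_axis_mul_rho i (-e)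
  form_eq := by
    simp only [form_axis_left, oneCoord_apply, φ_axis, δ_axis, γ_axis, if_true, Units.val_neg,
      Int.cast_neg]
    linear_combination (-7 / 2) * sign_mul_self e

theorem isTable4B : IsTable4B form (axis : ι × ℤˣ → Model4B ι) rho where
  mul_self p := (isMonsterAxis p).idem
  third_mul_self := rho_mul_self
  pair := isDihedral2A
  mul_of_ne {i j} hij e d := by
    ext k
    · by_cases hi : k = i
      · simp [hi, hij]
      · by_cases hj : k = j <;> simp [hi, hj, hij.symm]
    · by_cases hi : k = i
      · simp only [hi, hij, map_smul, map_add, map_sub, smul_eq_mul, δ_mul, φ_axis, δ_axis, γ_axis,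
          δ_rho, if_true, if_false, Units.val_neg, Int.cast_neg]
        ring
      · by_cases hj : k = j
        · simp only [hj, hij.symm, map_smul, map_add, map_sub, smul_eq_mul, δ_mul, φ_axis, δ_axis,
            γ_axis, δ_rho, if_true, if_false, Units.val_neg, Int.cast_neg]
          ring
        · simp [hi, hj]
    · simp only [hij.symm, map_smul, map_add, map_sub, smul_eq_mul, γ_mul, γ_axis, γ_rho, δ_axis,
        mul_ite, mul_zero, Finset.sum_ite_eq', Finset.mem_univ, if_true, if_false]
      norm_num
  form_self p := by rw [form_axis_left, oneCoord_axis]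
  form_third_self := by simp [form_apply]
  form_third_right p := by simp [form_axis_left, oneCoord_apply]
  form_third_left p := by simp [form_apply]
  form_of_ne hij e d := by
    simp only [form_axis_left, oneCoord_apply, φ_axis, δ_axis, γ_axis, hij, if_false]
    norm_num

theorem eq_sum_axis_add_rho (x : Model4B ι) : x =
    ∑ i, ((4 / 5 * φ i x + δ i x) • axis (i, 1) + (4 / 5 * φ i x - δ i x) • axis (i, -1)) +
      (γ x - 1 / 5 * ∑ i, φ i x) • rho := by
  ext j
  · simp only [map_add, map_sum, map_smul, smul_eq_mul, φ_axis, φ_rho, Finset.sum_add_distrib,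
      mul_ite, mul_zero, Finset.sum_ite_eq, Finset.mem_univ, if_true]
    ring
  · simp only [map_add, map_sum, map_smul, smul_eq_mul, δ_axis, δ_rho, Finset.sum_add_distrib,
      mul_ite, mul_zero, Finset.sum_ite_eq, Finset.mem_univ, if_true, Units.val_one, Units.val_neg,
      Int.cast_one, Int.cast_neg]
    ring
  · simp only [map_add, map_sum, map_smul, smul_eq_mul, γ_axis, γ_rho, Finset.sum_add_distrib,
      Finset.sum_sub_distrib, ← Finset.sum_mul, ← Finset.mul_sum]
    ring

theorem span_axis_rho : Submodule.span ℝ (insert rho (Set.range (axis : ι × ℤˣ → _))) = ⊤ := by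
  rw [eq_top_iff]
  rintro x -
  rw [eq_sum_axis_add_rho x]
  have hmem {y : Model4B ι} (hy : y ∈ insert rho (Set.range axis)) (r : ℝ) :
      r • y ∈ Submodule.span ℝ (insert rho (Set.range (axis : ι × ℤˣ → Model4B ι))) :=
    Submodule.smul_mem _ r (Submodule.subset_span hy)
  exact add_mem (sum_mem fun i _ ↦ add_mem (hmem (.inr ⟨_, rfl⟩) _) (hmem (.inr ⟨_, rfl⟩) _))
    (hmem (.inl rfl) _)

/-- The basis of the axes and `a_ρ`. -/
noncomputable def axisBasis : Module.Basis (Option (ι × ℤˣ)) ℝ (Model4B ι) :=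
  basisOfTopLeSpanOfCardEqFinrank (Option.elim' rho axis)
    (span_axis_rho.symm.le.trans (Submodule.span_mono
      (Set.insert_subset ⟨none, rfl⟩ (Set.range_subset_iff.2 fun p ↦ ⟨some p, rfl⟩))))
    (by
      have : Module.finrank ℝ (Model4B ι) = Module.finrank ℝ ((ι → ℝ) × (ι → ℝ) × ℝ) := rfl
      simp only [this, Fintype.card_option, Fintype.card_prod, Fintype.card_units_int,
        Module.finrank_prod, Module.finrank_fintype_fun_eq_card, Module.finrank_self]
      ring)

@[simp] theorem axisBasis_some (p : ι × ℤˣ) : axisBasis (some p) = (axis p : Model4B ι) := by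
  simp [axisBasis]

@[simp] theorem axisBasis_none : axisBasis none = (rho : Model4B ι) := by
  simp [axisBasis]

theorem adjoin_axis [Nonempty ι] :
    NonUnitalAlgebra.adjoin ℝ (Set.range (axis : ι × ℤˣ → Model4B ι)) = ⊤ := by
  have hmem (p : ι × ℤˣ) : axis p ∈ NonUnitalAlgebra.adjoin ℝ (Set.range axis) :=
    NonUnitalAlgebra.subset_adjoin ℝ (Set.mem_range_self p)
  inhabit ι
  have hrho := isTable4B.third_mem (hmem (default, 1)) (hmem (default, -1))
  rw [← NonUnitalAlgebra.toSubmodule_eq_top, eq_top_iff, ← span_axis_rho, Submodule.span_le]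
  rintro _ (rfl | ⟨p, rfl⟩)
  exacts [hrho, hmem p]

theorem isDihedral4B :
    IsDihedral4B ℝ form (axis (0, 1)) (axis (1, 1)) (axis (1, -1))
      (axis (0, -1) : Model4B (Fin 3)) := by
  have hinj : Function.Injective
      ![some ((1, -1) : AxisIndex), some (0, 1), some (1, 1), some (0, -1), none] := by
    decide
  refine isTable4B.isDihedral4B (by decide) ?_
  have hcomp : ![axis (1, -1), axis (0, 1), axis (1, 1), axis (0, -1), rho] = axisBasis ∘
      ![some ((1, -1) : AxisIndex), some (0, 1), some (1, 1), some (0, -1), none] := by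
    ext k : 1
    fin_cases k <;> simp
  exact hcomp ▸ axisBasis.linearIndependent.comp _ hinj

end Universal

end Model4B

theorem IsDihedral2A.form_third {R M : Type*} [CommRing R] [Algebra ℝ R]
    [NonUnitalNonAssocCommRing M] [Module R M] [SMulCommClass R M M]
    {form : LinearMap.BilinForm R M} {a a' c : M} (h : IsDihedral2A form a a' c)
    (hform : ∀ u v w : M, form u (v * w) = form (u * v) w) (ha : IsPrimitiveMonsterAxis form a) :
    8 * form a c = 1 := by
  have hmul := congrArg (form a) h.mul_eq
  simp only [map_smul, map_add, map_sub, smul_eq_mul, hform, ha.mul_self, ha.form_self] at hmul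
  linear_combination 8 * hmul - 7 * h.form_eq

namespace IsShape4B

variable {𝓐 : MarkedFrobeniusAlgebra.{u} AxisIndex} (h : IsShape4B 𝓐)
include h

theorem isPrimitiveMonsterAxis (p : AxisIndex) : IsPrimitiveMonsterAxis 𝓐.form (𝓐.gen p) :=
  ⟨h.axis p, h.primitive p, h.form_axis p⟩

theorem isMiyamotoPair {i j : Fin 3} (hij : i ≠ j) (e d : ℤˣ) :
    IsMiyamotoPair 𝓐.R (𝓐.gen (i, e)) (𝓐.gen (j, d)) (𝓐.gen (j, -d)) := by
  obtain ⟨τ, hτ, hperm⟩ := h.miyamoto (i, e)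
  have hmap : τ (𝓐.gen (j, d)) = 𝓐.gen (j, -d) := by
    rw [hperm, axisPerm, if_neg hij.symm]
  exact hmap ▸ (h.isPrimitiveMonsterAxis (i, e)).isMiyamotoPair hτ _

theorem isMiyamotoQuad {i j : Fin 3} (hij : i ≠ j) (e d : ℤˣ) :
    IsMiyamotoQuad 𝓐.form (𝓐.gen (i, e)) (𝓐.gen (i, -e)) (𝓐.gen (j, d)) (𝓐.gen (j, -d)) where
  axis_left := h.isPrimitiveMonsterAxis _
  axis_left' := h.isPrimitiveMonsterAxis _
  axis_right := h.isPrimitiveMonsterAxis _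
  axis_right' := h.isPrimitiveMonsterAxis _
  pair_left := h.isMiyamotoPair hij e d
  pair_left' := h.isMiyamotoPair hij (-e) d
  pair_right := h.isMiyamotoPair hij.symm d e
  pair_right' := h.isMiyamotoPair hij.symm (-d) e

theorem gen_ne_gen_neg (i : Fin 3) (e : ℤˣ) : 𝓐.gen (i, e) ≠ 𝓐.gen (i, -e) := by
  refine h.gen_injective.ne fun hp ↦ ?_
  exact units_ne_neg_self e (congrArg Prod.snd hp)

theorem exists_isTable4B : ∃ c, IsTable4B 𝓐.form 𝓐.gen c := by
  obtain ⟨c, -, -, ⟨-, -, -, -, hcc⟩, -, ⟨h02, -, h0c, h2c, -, -⟩, ⟨-, -, -, -, hformc⟩, -,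
    hform02, -⟩ := h.shape
  have pair_zero : IsDihedral2A 𝓐.form (𝓐.gen (0, 1)) (𝓐.gen (0, -1)) c :=
    ⟨h02, h0c, h2c, by
      rw [hform02, ← map_ofNat (algebraMap ℝ 𝓐.R), ← map_mul, ← map_one (algebraMap ℝ 𝓐.R)]
      norm_num⟩
  have pair_of_ne {i j e} (hij : i ≠ j) (hi : IsDihedral2A 𝓐.form (𝓐.gen (i, e)) (𝓐.gen (i, -e)) c)
      (d) : IsDihedral2A 𝓐.form (𝓐.gen (j, d)) (𝓐.gen (j, -d)) c :=
    (h.isMiyamotoQuad hij e d).isDihedral2A_right 𝓐.form_assoc hi (h.gen_ne_gen_neg j d)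
  have pair (i e) : IsDihedral2A 𝓐.form (𝓐.gen (i, e)) (𝓐.gen (i, -e)) c := by
    rcases eq_or_ne 0 i with rfl | hi
    · exact pair_of_ne one_ne_zero (pair_of_ne zero_ne_one pair_zero 1) e
    · exact pair_of_ne hi pair_zero e
  have form_third (p : AxisIndex) : 8 * 𝓐.form (𝓐.gen p) c = 1 :=
    (pair p.1 p.2).form_third 𝓐.form_assoc (h.isPrimitiveMonsterAxis p)
  exact ⟨c,
    { mul_self := fun p ↦ (h.axis p).idem
      third_mul_self := hcc
      pair := pair
      mul_of_ne := fun {i j} hij e d ↦ (h.isMiyamotoQuad hij e d).mul_eq 𝓐.form_assoc (pair i e)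
        (h.gen_ne_gen_neg j d)
      form_self := h.form_axis
      form_third_self := hformc
      form_third_right := form_third
      form_third_left := fun p ↦
        (h.isPrimitiveMonsterAxis p).form_comm 𝓐.form_assoc c ▸ form_third p
      form_of_ne := fun {i j} hij e d ↦ (h.isMiyamotoQuad hij e d).form_left_right_eq 𝓐.form_assoc
        (pair i e).form_eq (h.gen_ne_gen_neg j d) }⟩

end IsShape4B

/-- The universal algebra of shape `4B`. -/
noncomputable def universal4B : MarkedFrobeniusAlgebra.{0} AxisIndex where
  R := ℝ
  M := Model4B (Fin 3)
  gen := Model4B.axis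
  form := Model4B.form
  form_assoc := Model4B.form_assoc
  adjoin_gen := Model4B.adjoin_axis
  adjoin_form := by
    rw [eq_top_iff]
    rintro r -
    exact Subalgebra.algebraMap_mem _ r

theorem isShape4B_universal4B : IsShape4B universal4B where
  gen_injective := Model4B.axis_injective
  axis := Model4B.isMonsterAxis
  primitive := Model4B.isPrimitiveAxis
  form_axis := Model4B.isTable4B.form_self
  miyamoto p := ⟨Model4B.reflection p.1, Model4B.isMiyamotoInvolution p, Model4B.reflection_axis p⟩
  shape := Model4B.isDihedral4B

namespace MarkedFrobeniusAlgebra.Hom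

variable {ι : Type} {𝓐 : MarkedFrobeniusAlgebra.{u} ι} {𝓑 : MarkedFrobeniusAlgebra.{v} ι}

theorem surjective_ringMap (f : Hom 𝓐 𝓑) : Function.Surjective f.ringMap := by
  have exists_map_eq : ∀ x ∈ Subsemigroup.closure (Set.range 𝓑.gen), ∃ y, f.map y = x := by
    intro x hx
    induction hx using Subsemigroup.closure_induction with
    | mem x hx =>
      obtain ⟨i, rfl⟩ := hx
      exact ⟨_, f.map_gen i⟩
    | mul x y _ _ hx hy =>
      obtain ⟨x', rfl⟩ := hx
      obtain ⟨y', rfl⟩ := hy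
      exact ⟨_, f.map_mul x' y'⟩
  rw [← AlgHom.range_eq_top, eq_top_iff, ← 𝓑.adjoin_form, Algebra.adjoin_le_iff]
  rintro r ⟨x, hx, y, hy, rfl⟩
  obtain ⟨x', rfl⟩ := exists_map_eq x hx
  obtain ⟨y', rfl⟩ := exists_map_eq y hy
  exact ⟨_, (f.map_form x' y').symm⟩

theorem surjective_map (f : Hom 𝓐 𝓑) : Function.Surjective f.map := by
  let S : NonUnitalSubalgebra 𝓑.R 𝓑.M :=
    { carrier := Set.range f.map
      add_mem' := by
        rintro _ _ ⟨x, rfl⟩ ⟨y, rfl⟩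
        exact ⟨x + y, map_add _ _ _⟩
      zero_mem' := ⟨0, map_zero _⟩
      mul_mem' := by
        rintro _ _ ⟨x, rfl⟩ ⟨y, rfl⟩
        exact ⟨x * y, f.map_mul _ _⟩
      smul_mem' := by
        rintro r _ ⟨x, rfl⟩
        obtain ⟨s, rfl⟩ := f.surjective_ringMap r
        exact ⟨s • x, f.map_smul _ _⟩ }
  have hS : NonUnitalAlgebra.adjoin 𝓑.R (Set.range 𝓑.gen) ≤ S := by
    apply NonUnitalAlgebra.adjoin_le
    rintro _ ⟨i, rfl⟩
    exact ⟨_, f.map_gen i⟩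
  rw [𝓑.adjoin_gen] at hS
  exact fun x ↦ hS (x := x) trivial

theorem eq_of_ringMap_eq {f g : Hom 𝓐 𝓑} (h : f.ringMap = g.ringMap) : f = g := by
  have hmap : ∀ x, f.map x = g.map x := by
    intro x
    have hx : x ∈ NonUnitalAlgebra.adjoin 𝓐.R (Set.range 𝓐.gen) := by
      rw [𝓐.adjoin_gen]
      trivial
    induction hx using NonUnitalAlgebra.adjoin_induction with
    | mem x hx =>
      obtain ⟨i, rfl⟩ := hx
      rw [f.map_gen, g.map_gen]
    | add x y _ _ hx hy => rw [map_add, map_add, hx, hy]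
    | zero => rw [map_zero, map_zero]
    | mul x y _ _ hx hy => rw [f.map_mul, g.map_mul, hx, hy]
    | smul r x _ hx => rw [f.map_smul, g.map_smul, hx, h]
  exact Hom.ext h (AddMonoidHom.ext hmap)

end MarkedFrobeniusAlgebra.Hom

section Initial

variable {𝓑 : MarkedFrobeniusAlgebra.{v} AxisIndex} {c : 𝓑.M}

/-- The semilinear map of the model to `𝓑` that sends the axes to the axes and `a_ρ` to `c`. -/
noncomputable def modelMap (𝓑 : MarkedFrobeniusAlgebra.{v} AxisIndex) (c : 𝓑.M) :
    Model4B (Fin 3) →ₛₗ[algebraMap ℝ 𝓑.R] 𝓑.M :=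
  semilinearExtension _ Model4B.axisBasis (Option.elim' c 𝓑.gen)

theorem modelMap_axis (p : AxisIndex) : modelMap 𝓑 c (Model4B.axis p) = 𝓑.gen p := by
  rw [modelMap, ← Model4B.axisBasis_some, semilinearExtension_apply_basis, Option.elim'_some]

theorem modelMap_rho : modelMap 𝓑 c Model4B.rho = c := by
  rw [modelMap, ← Model4B.axisBasis_none, semilinearExtension_apply_basis, Option.elim'_none]

/-- The morphism of the universal algebra of shape `4B` to an algebra that satisfies the same
table. -/
noncomputable def IsTable4B.hom (T : IsTable4B 𝓑.form 𝓑.gen c) :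
    MarkedFrobeniusAlgebra.Hom universal4B 𝓑 where
  ringMap := Algebra.ofId ℝ 𝓑.R
  map := (modelMap 𝓑 c).toAddMonoidHom
  map_smul := map_smulₛₗ (modelMap 𝓑 c)
  map_mul := Model4B.isTable4B.map_mul T modelMap_axis modelMap_rho Model4B.span_axis_rho
  map_form := Model4B.isTable4B.map_form T modelMap_axis modelMap_rho Model4B.span_axis_rho
  map_gen := modelMap_axis

theorem isUniversal4B_universal4B : IsUniversal4B.{0, v} universal4B := by
  refine ⟨isShape4B_universal4B, fun 𝓑 h ↦ ?_⟩
  obtain ⟨c, T⟩ := h.exists_isTable4B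
  exact ⟨T.hom, T.hom.surjective_ringMap, T.hom.surjective_map, fun g ↦
    MarkedFrobeniusAlgebra.Hom.eq_of_ringMap_eq (Subsingleton.elim (α := ℝ →ₐ[ℝ] 𝓑.R) _ _)⟩

theorem modelMap_injective (T : IsTable4B 𝓑.form 𝓑.gen c) : Function.Injective (modelMap 𝓑 c) := by
  rw [injective_iff_map_eq_zero]
  intro x hx
  have hform : 𝓑.form (modelMap 𝓑 c x) (modelMap 𝓑 c x) = algebraMap ℝ 𝓑.R (Model4B.form x x) :=
    T.hom.map_form x x
  rw [hx, map_zero, eq_comm, map_eq_zero_iff _ (algebraMap ℝ 𝓑.R).injective] at hform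
  exact Model4B.form_self_eq_zero hform

end Initial

namespace IsShape4B

variable {𝓐 : MarkedFrobeniusAlgebra.{u} AxisIndex} (h : IsShape4B 𝓐)
include h

theorem bijective_algebraMap : Function.Bijective (algebraMap ℝ 𝓐.R) := by
  obtain ⟨c, T⟩ := h.exists_isTable4B
  exact ⟨(algebraMap ℝ 𝓐.R).injective, T.hom.surjective_ringMap⟩

theorem exists_basis : ∃ b : Module.Basis (Option AxisIndex) 𝓐.R 𝓐.M,
    (∀ i, b (some i) = 𝓐.gen i) ∧ b none = aRho 𝓐 := by
  obtain ⟨c, T⟩ := h.exists_isTable4B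
  have hc : c = aRho 𝓐 := by
    rw [aRho, (T.pair 0 1).mul_eq, sub_sub_cancel]
  have hLI : LinearIndependent 𝓐.R (modelMap 𝓐 c ∘ Model4B.axisBasis) :=
    Model4B.axisBasis.linearIndependent.map_of_surjective_injective (algebraMap ℝ 𝓐.R)
      (modelMap 𝓐 c).toAddMonoidHom T.hom.surjective_ringMap
      ((injective_iff_map_eq_zero _).1 (modelMap_injective T)) (map_smulₛₗ (modelMap 𝓐 c))
  have hspan : ⊤ ≤ Submodule.span 𝓐.R (Set.range (modelMap 𝓐 c ∘ Model4B.axisBasis)) := by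
    rintro x -
    obtain ⟨y, rfl⟩ : ∃ y, modelMap 𝓐 c y = x := T.hom.surjective_map x
    rw [← Model4B.axisBasis.sum_repr y, map_sum]
    refine Submodule.sum_mem _ fun k _ ↦ ?_
    rw [map_smulₛₗ]
    exact Submodule.smul_mem _ _ (Submodule.subset_span ⟨k, rfl⟩)
  refine ⟨Module.Basis.mk hLI hspan, fun p ↦ ?_, ?_⟩
  · rw [Module.Basis.mk_apply, Function.comp_apply, Model4B.axisBasis_some, modelMap_axis]
  · rw [Module.Basis.mk_apply, Function.comp_apply, Model4B.axisBasis_none, modelMap_rho, hc]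

theorem finrank_eq_seven : Module.finrank 𝓐.R 𝓐.M = 7 := by
  obtain ⟨b, -⟩ := h.exists_basis
  rw [Module.finrank_eq_card_basis b]
  rfl

end IsShape4B

theorem theorem4p1_general :
    (∃ 𝓐 : MarkedFrobeniusAlgebra.{0} AxisIndex, IsUniversal4B.{0, v} 𝓐) ∧
    ∀ 𝓐 : MarkedFrobeniusAlgebra.{u} AxisIndex, IsShape4B 𝓐 →
      Function.Bijective (algebraMap ℝ 𝓐.R) ∧
      Module.finrank 𝓐.R 𝓐.M = 7 ∧
      ∃ b : Module.Basis (Option AxisIndex) 𝓐.R 𝓐.M,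
        (∀ i, b (some i) = 𝓐.gen i) ∧ b none = aRho 𝓐 :=
  ⟨⟨universal4B, isUniversal4B_universal4B⟩, fun _ h ↦
    ⟨h.bijective_algebraMap, h.finrank_eq_seven, h.exists_basis⟩⟩

theorem theorem4p1 :
    (∃ 𝓐 : MarkedFrobeniusAlgebra.{0} AxisIndex, IsUniversal4B.{0, v} 𝓐) ∧
    ∀ 𝓐 : MarkedFrobeniusAlgebra.{u} AxisIndex, IsUniversal4B.{u, v} 𝓐 →
      Function.Bijective (algebraMap ℝ 𝓐.R) ∧
      Module.finrank 𝓐.R 𝓐.M = 7 ∧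
      ∃ b : Module.Basis (Option AxisIndex) 𝓐.R 𝓐.M,
        (∀ i, b (some i) = 𝓐.gen i) ∧ b none = aRho 𝓐 :=
  ⟨theorem4p1_general.{u, v}.1, fun 𝓐 h ↦ theorem4p1_general.{u, v}.2 𝓐 h.1⟩
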